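/- Let $1\le N\le 4$, let $\Omega\subset\mathbb{R}^N$ be a bounded open set (for instance a bounded domain with Lipschitz boundary), let $m\in\mathbb{N}$ and $\varepsilon_1,\dots,\varepsilon_m>0$. Let $H=H_0^1(\Omega,\mathbb{R}^m)$, with $\|\mathbf u\|_H=\big(\int_\Omega\sum_{i=1}^m\varepsilon_i|\nabla u_i|^2\,dx\big)^{1/2}$. Let $\lambda_1$ be the first Dirichlet eigenvalue of $-\Delta$ in $\Omega$. Let $\mathbf g=(g_{ij})\in\mathbb{R}^{m\times m}$ be a symmetric matrix such that either $g_{ij}>0$ for all $i,j$, or $\mathbf g$ is positive definite. Let $a_1,\dots,a_m\in L^\infty(\Omega)$ satisfy $a_i(x)>-\varepsilon_i\lambda_1$ for a.e. $x\in\Omega$ and all $i$. For $\mathbf u\in H$ put $$K(\mathbf u)=\int_\Omega\sum_{i=1}^m\big(\varepsilon_i|\nabla u_i|^2+a_iu_i^2\big)dx,\qquad I(\mathbf u)=\int_\Omega\sum_{i,j=1}^m g_{ij}u_i^2u_j^2\,dx,\qquad E(\mathbf u)=\tfrac12K(\mathbf u)-\tfrac14I(\mathbf u).$$ Then $E\in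 C^2(H,\mathbb{R})$. Let $\mathcal N=\{\mathbf u\in H\setminus\{0\}:\langle E'(\mathbf u),\mathbf u\rangle=0\}$, where $E'$ and $E''$ are Fréchet derivatives. The following hold. (i) For every $\mathbf v\in H\setminus\{0\}$, the function $s\mapsto E(s\mathbf v)$ has a unique critical point $s_{\mathbf v}$ in $(0,\infty)$, and $s_{\mathbf v}\mathbf v\in\mathcal N$. Moreover $$s_{\mathbf v}=\Big(\frac{K(\mathbf v)}{I(\mathbf v)}\Big)^{1/2}=\left(\frac{\sum_{i=1}^m\int_\Omega(\varepsilon_i|\nabla v_i|^2+a_iv_i^2)\,dx}{\sum_{i,j=1}^m\int_\Omega g_{ij}v_i^2v_j^2\,dx}\right)^{1/2}.$$ (ii) $\langle E''(\mathbf u)\mathbf u,\mathbf u\rangle<0$ for all $\mathbf u\in\mathcal N$. (iii) There is a constant $\sigma_0>0$ such that $\|\mathbf u\|_H\ge\sigma_0$ for all $\mathbf u\in\mathcal N$. -/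

import Mathlib

open MeasureTheory
open scoped ContDiff Gradient

noncomputable section

namespace NehariSystem

/-- `ℝ^N` with its Euclidean norm. -/
abbrev Space (N : ℕ) : Type := EuclideanSpace ℝ (Fin N)

/-- Lebesgue measure on `Ω`. -/
abbrev vol {N : ℕ} (Ω : Set (Space N)) : Measure (Space N) := volume.restrict Ω

/-- The Hilbert space `L²(Ω) × L²(Ω; ℝ^N)`, with norm `(‖f‖² + ‖F‖²)^{1/2}`. -/
abbrev L2Pair {N : ℕ} (Ω : Set (Space N)) : Type :=
  WithLp 2 (Lp ℝ 2 (vol Ω) × Lp (Space N) 2 (vol Ω))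

/-- `φ ∈ C_c^∞(Ω)`. -/
structure IsTestFunction {N : ℕ} (Ω : Set (Space N)) (φ : Space N → ℝ) : Prop where
  smooth : ContDiff ℝ ∞ φ
  compact : HasCompactSupport φ
  support : tsupport φ ⊆ Ω

/-- The set of the pairs `(φ, ∇φ)` with `φ ∈ C_c^∞(Ω)`, as a subspace of `L²(Ω) × L²(Ω; ℝ^N)`. -/
def testPairs {N : ℕ} (Ω : Set (Space N)) : Submodule ℝ (L2Pair Ω) where
  carrier := {p | ∃ φ : Space N → ℝ, IsTestFunction Ω φ ∧
    p.fst =ᵐ[vol Ω] φ ∧ p.snd =ᵐ[vol Ω] ∇ φ}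
  zero_mem' := by
    refine ⟨fun _ => 0, ⟨contDiff_const, HasCompactSupport.zero, by simp [tsupport]⟩, ?_, ?_⟩
    · exact Lp.coeFn_zero _ _ _
    · refine (Lp.coeFn_zero _ _ _).trans (Filter.Eventually.of_forall fun x => ?_)
      simp [gradient]
  add_mem' := by
    rintro p q ⟨φ, hφ, h1, h2⟩ ⟨ψ, hψ, h3, h4⟩
    refine ⟨fun x => φ x + ψ x, ⟨hφ.smooth.add hψ.smooth, hφ.compact.add hψ.compact,
      (tsupport_add φ ψ).trans (Set.union_subset hφ.support hψ.support)⟩, ?_, ?_⟩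
    · filter_upwards [Lp.coeFn_add p.fst q.fst, h1, h3] with x hx hx1 hx3
      rw [← hx1, ← hx3]
      exact hx
    · filter_upwards [Lp.coeFn_add p.snd q.snd, h2, h4] with x hx hx2 hx4
      have d1 : DifferentiableAt ℝ φ x := (hφ.smooth.differentiable (by simp)) x
      have d2 : DifferentiableAt ℝ ψ x := (hψ.smooth.differentiable (by simp)) x
      have : ∇ (fun x => φ x + ψ x) x = ∇ φ x + ∇ ψ x := by
        simp [gradient, fderiv_fun_add d1 d2]
      rw [this, ← hx2, ← hx4]
      exact hx
  smul_mem' := by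
    rintro c p ⟨φ, hφ, h1, h2⟩
    refine ⟨fun x => c • φ x, ⟨hφ.smooth.const_smul c, hφ.compact.smul_left (f := fun _ => c),
      (closure_mono (Function.support_const_smul_subset c φ)).trans hφ.support⟩, ?_, ?_⟩
    · filter_upwards [Lp.coeFn_smul c p.fst, h1] with x hx hx1
      rw [← hx1]
      exact hx
    · filter_upwards [Lp.coeFn_smul c p.snd, h2] with x hx hx2
      have d1 : DifferentiableAt ℝ φ x := (hφ.smooth.differentiable (by simp)) x
      have : ∇ (fun x => c • φ x) x = c • ∇ φ x := by
        simp only [gradient, fderiv_fun_const_smul d1 c]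
        simp
      rw [this, ← hx2]
      exact hx

/-- The Sobolev space `H_0^1(Ω)`: the closure of `C_c^∞(Ω)` in the `H^1` norm
`(‖u‖²_{L²} + ‖∇u‖²_{L²})^{1/2}`. A function `u ∈ H_0^1(Ω)` is represented by the pair `(u, ∇u)` of
itself and its weak gradient: if `φ_n → u` and `∇φ_n → F` in `L²` with `φ_n ∈ C_c^∞(Ω)`, then
`F` is the weak gradient of `u`, so it is determined by `u`. -/
abbrev H01 {N : ℕ} (Ω : Set (Space N)) : Submodule ℝ (L2Pair Ω) :=
  (testPairs Ω).topologicalClosure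

/-- The function `u` (up to null sets) underlying an element of `H_0^1(Ω)`. -/
def fn {N : ℕ} {Ω : Set (Space N)} (u : H01 Ω) : Space N → ℝ := (u : L2Pair Ω).fst

/-- The weak gradient `∇u` of `u ∈ H_0^1(Ω)`. -/
def grad {N : ℕ} {Ω : Set (Space N)} (u : H01 Ω) : Space N → Space N := (u : L2Pair Ω).snd

/-- `μ` is an eigenvalue of the Dirichlet Laplacian `-Δ` in `Ω` (weak formulation). -/
def IsDirichletEigenvalue {N : ℕ} (Ω : Set (Space N)) (μ : ℝ) : Prop :=
  ∃ φ : H01 Ω, φ ≠ 0 ∧ ∀ ψ : H01 Ω,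
    ∫ x in Ω, inner ℝ (grad φ x) (grad ψ x) = μ * ∫ x in Ω, fn φ x * fn ψ x

/-- The first Dirichlet eigenvalue `λ₁` of `-Δ` in `Ω`. -/
def firstEigenvalue {N : ℕ} (Ω : Set (Space N)) : ℝ := sInf {μ | IsDirichletEigenvalue Ω μ}

/-- `H = H_0^1(Ω, ℝ^m)`, with its `H^1` norm. (The weighted norm `hNorm` below is equivalent to it
on a bounded `Ω`, so that both give the same Fréchet derivatives.) -/
abbrev H {N : ℕ} (Ω : Set (Space N)) (m : ℕ) : Type := PiLp 2 (fun _ : Fin m => H01 Ω)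

variable {N m : ℕ} {Ω : Set (Space N)}

/-- The norm `‖u‖_H = (∫_Ω ∑ᵢ εᵢ |∇uᵢ|²)^{1/2}`. -/
def hNorm (ε : Fin m → ℝ) (u : H Ω m) : ℝ :=
  Real.sqrt (∫ x in Ω, ∑ i, ε i * ‖grad (u i) x‖ ^ 2)

/-- `K(u) = ∫_Ω ∑ᵢ (εᵢ |∇uᵢ|² + aᵢ uᵢ²)`. -/
def K (ε : Fin m → ℝ) (a : Fin m → Space N → ℝ) (u : H Ω m) : ℝ :=
  ∫ x in Ω, ∑ i, (ε i * ‖grad (u i) x‖ ^ 2 + a i x * fn (u i) x ^ 2)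

/-- `I(u) = ∫_Ω ∑ᵢⱼ gᵢⱼ uᵢ² uⱼ²`. -/
def I (g : Matrix (Fin m) (Fin m) ℝ) (u : H Ω m) : ℝ :=
  ∫ x in Ω, ∑ i, ∑ j, g i j * fn (u i) x ^ 2 * fn (u j) x ^ 2

/-- The energy `E(u) = K(u)/2 - I(u)/4`. -/
def E (ε : Fin m → ℝ) (a : Fin m → Space N → ℝ) (g : Matrix (Fin m) (Fin m) ℝ) (u : H Ω m) : ℝ :=
  1 / 2 * K ε a u - 1 / 4 * I g u

/-- The Nehari manifold `{u ∈ H \ {0} : ⟨E'(u), u⟩ = 0}`. -/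
def nehari (Ω : Set (Space N)) (ε : Fin m → ℝ) (a : Fin m → Space N → ℝ)
    (g : Matrix (Fin m) (Fin m) ℝ) : Set (H Ω m) :=
  {u | u ≠ 0 ∧ fderiv ℝ (E ε a g) u u = 0}

end NehariSystem

end

open MeasureTheory Filter Topology
open scoped ContDiff Gradient ENNReal NNReal

noncomputable section

namespace NehariSystem

/-! ### Translation estimates and the Poincaré inequality for test functions. -/

section

section Translation

variable {E : Type*} [NormedAddCommGroup E] [NormedSpace ℝ E]

/-! On a ray, `E (s • v)` is `s² K(v) / 2 - s⁴ I(v) / 4`. If `K(v)` and `I(v)` are positive, its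
derivative `s K - s³ I` has the single positive zero `√(K / I)`. On the Nehari set `K = I`, so the
second derivative in the direction `u` is `K - 3 I = -2 K < 0`; and `c ‖u‖² ≤ K = I ≤ D ‖u‖⁴` keeps
`‖u‖` away from zero. The work lies in the analytic facts behind this.

Smoothness of `E` and the bound on `I` come from the Sobolev embedding into `L⁴`, valid for `N ≤ 4`:
it makes `(u, v) ↦ u v` a bounded bilinear map into `L²` (`exists_product`), so `E` is a polynomial
in continuous linear and bilinear maps.

Since `λ₁` is an infimum of eigenvalues, its Rayleigh bound needs a minimizer that is an eigenvector
(`exists_rayleigh_minimizer`). This rests on the Rellich theorem (`isCompactOperator_toL2`), proved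
by approximating the inclusion with finite-rank averaging operators. The strict inequality `aᵢ > -εᵢ
λ₁` then gives only positivity of the form, as `aᵢ` may come arbitrarily close to the bound;
compactness upgrades positivity to coercivity (`exists_coercive_of_compact`).

Elements of `H01 Ω` are pairs, so passing from a function vanishing a.e. to a zero element needs
`toL2_injective`. -/

theorem sq_lintegral_le {α : Type*} [MeasurableSpace α] {μ : Measure α} {f : α → ℝ≥0∞}
    (hf : AEMeasurable f μ) : (∫⁻ t, f t ∂μ) ^ 2 ≤ μ Set.univ * ∫⁻ t, f t ^ 2 ∂μ := by
  have h := ENNReal.lintegral_mul_le_Lp_mul_Lq μ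
    Real.HolderConjugate.two_two hf (aemeasurable_const (b := (1 : ℝ≥0∞)))
  simp only [Pi.mul_apply, mul_one, ENNReal.rpow_two] at h
  simp only [one_pow, lintegral_one] at h
  have hs : ∀ a : ℝ≥0∞, (a ^ (1 / 2 : ℝ)) ^ 2 = a := fun a => by
    rw [← ENNReal.rpow_natCast, ← ENNReal.rpow_mul]; norm_num
  calc _ ≤ ((∫⁻ t, f t ^ 2 ∂μ) ^ (1 / 2 : ℝ) * μ Set.univ ^ (1 / 2 : ℝ)) ^ 2 := by gcongr
    _ = _ := by rw [mul_pow, hs, hs, mul_comm]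

/-- The fundamental theorem of calculus on the segment from `x` to `x + z`, then Cauchy–Schwarz on
the unit interval. -/
theorem enorm_sub_sq_le_lintegral_fderiv {φ : E → ℝ} (hφ : ContDiff ℝ 1 φ) (x z : E) :
    ‖φ (x + z) - φ x‖ₑ ^ 2 ≤
      ‖z‖ₑ ^ 2 * ∫⁻ t in Set.Icc (0 : ℝ) 1, ‖fderiv ℝ φ (x + t • z)‖ₑ ^ 2 := by
  have hc : Continuous fun t : ℝ => fderiv ℝ φ (x + t • z) :=
    (hφ.continuous_fderiv (by simp)).comp (by fun_prop)
  have hd : ∀ t : ℝ, HasDerivAt (fun t : ℝ => φ (x + t • z)) (fderiv ℝ φ (x + t • z) z) t := by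
    intro t
    have h1 : HasDerivAt (fun t : ℝ => x + t • z) z t := by
      simpa using ((hasDerivAt_id t).smul_const z).const_add x
    exact ((hφ.differentiable (by simp)) _).hasFDerivAt.comp_hasDerivAt t h1
  have h2 := intervalIntegral.integral_eq_sub_of_hasDerivAt (a := 0) (b := 1) (fun t _ => hd t)
    ((hc.clm_apply continuous_const).intervalIntegrable 0 1)
  simp only [one_smul, zero_smul, add_zero] at h2
  rw [← h2, intervalIntegral.integral_of_le zero_le_one, ← integral_Icc_eq_integral_Ioc]
  calc _ ≤ (∫⁻ t in Set.Icc (0 : ℝ) 1, ‖z‖ₑ * ‖fderiv ℝ φ (x + t • z)‖ₑ) ^ 2 := by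
        gcongr
        refine (enorm_integral_le_lintegral_enorm _).trans (lintegral_mono fun t => ?_)
        rw [mul_comm]
        exact ContinuousLinearMap.le_opENorm _ _
    _ = ‖z‖ₑ ^ 2 * (∫⁻ t in Set.Icc (0 : ℝ) 1, ‖fderiv ℝ φ (x + t • z)‖ₑ) ^ 2 := by
        rw [lintegral_const_mul _ hc.enorm.measurable, mul_pow]
    _ ≤ _ := by
        gcongr
        simpa using sq_lintegral_le (μ := volume.restrict (Set.Icc (0 : ℝ) 1))
          hc.enorm.measurable.aemeasurable

variable [MeasurableSpace E] [BorelSpace E] [FiniteDimensional ℝ E] (μ : Measure E)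
  [μ.IsAddHaarMeasure]

/-- Tonelli and translation invariance remove the shift `t • z`. A large `z` gives Poincaré; small
`z` give Rellich. -/
theorem lintegral_enorm_translate_sub_sq_le {φ : E → ℝ} (hφ : ContDiff ℝ 1 φ) (z : E) :
    ∫⁻ x, ‖φ (x + z) - φ x‖ₑ ^ 2 ∂μ ≤ ‖z‖ₑ ^ 2 * ∫⁻ x, ‖fderiv ℝ φ x‖ₑ ^ 2 ∂μ := by
  have hc : Continuous (fderiv ℝ φ) := hφ.continuous_fderiv (by simp)
  have hm : Measurable (Function.uncurry fun (x : E) (t : ℝ) => ‖fderiv ℝ φ (x + t • z)‖ₑ ^ 2) := by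
    refine Continuous.measurable ?_
    have : Continuous fun p : E × ℝ => fderiv ℝ φ (p.1 + p.2 • z) := hc.comp (by fun_prop)
    exact (ENNReal.continuous_pow 2).comp this.enorm
  calc _ ≤ ∫⁻ x, (‖z‖ₑ ^ 2 * ∫⁻ t in Set.Icc (0 : ℝ) 1, ‖fderiv ℝ φ (x + t • z)‖ₑ ^ 2) ∂μ :=
        lintegral_mono fun x => enorm_sub_sq_le_lintegral_fderiv hφ x z
    _ = ‖z‖ₑ ^ 2 * ∫⁻ t in Set.Icc (0 : ℝ) 1, (∫⁻ x, ‖fderiv ℝ φ (x + t • z)‖ₑ ^ 2 ∂μ) := by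
        rw [lintegral_const_mul' _ _ (by finiteness), lintegral_lintegral_swap hm.aemeasurable]
    _ = _ := by
        simp_rw [lintegral_add_right_eq_self (μ := μ) (fun x => ‖fderiv ℝ φ x‖ₑ ^ 2)]
        simp

end Translation

variable {N : ℕ} {Ω : Set (Space N)} {φ : Space N → ℝ}

theorem IsTestFunction.contDiff_one (h : IsTestFunction Ω φ) : ContDiff ℝ 1 φ :=
  h.smooth.of_le (by simp)

theorem IsTestFunction.eq_zero (h : IsTestFunction Ω φ) {x : Space N} (hx : x ∉ Ω) : φ x = 0 :=
  image_eq_zero_of_notMem_tsupport fun h' => hx (h.support h')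

theorem IsTestFunction.fderiv_eq_zero (h : IsTestFunction Ω φ) {x : Space N} (hx : x ∉ Ω) :
    fderiv ℝ φ x = 0 :=
  image_eq_zero_of_notMem_tsupport fun h' => hx (h.support (tsupport_fderiv_subset ℝ h'))

theorem IsTestFunction.enorm_fderiv_eq_zero (h : IsTestFunction Ω φ) {x : Space N} (hx : x ∉ Ω) :
    ‖fderiv ℝ φ x‖ₑ = 0 := by
  rw [← ofReal_norm, h.fderiv_eq_zero hx, norm_zero, ENNReal.ofReal_zero]

theorem enorm_gradient (φ : Space N → ℝ) (x : Space N) : ‖∇ φ x‖ₑ = ‖fderiv ℝ φ x‖ₑ := by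
  rw [gradient, LinearIsometryEquiv.enorm_map]

theorem IsTestFunction.lintegral_fderiv (h : IsTestFunction Ω φ) :
    ∫⁻ x, ‖fderiv ℝ φ x‖ₑ ^ 2 = ∫⁻ x in Ω, ‖∇ φ x‖ₑ ^ 2 := by
  simp_rw [enorm_gradient]
  refine (setLIntegral_eq_of_support_subset ?_).symm
  intro x hx
  by_contra hx'
  exact hx (by simp [h.enorm_fderiv_eq_zero hx'])

/-- The **Poincaré inequality** for test functions on a bounded set. -/
theorem exists_lintegral_test_sq_le (hN : 1 ≤ N) (hΩ : IsOpen Ω) (hΩb : Bornology.IsBounded Ω) :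
    ∃ C : ℝ≥0, ∀ φ : Space N → ℝ, IsTestFunction Ω φ →
      ∫⁻ x in Ω, ‖φ x‖ₑ ^ 2 ≤ C * ∫⁻ x in Ω, ‖∇ φ x‖ₑ ^ 2 := by
  obtain ⟨R, hR⟩ := hΩb.subset_ball (0 : Space N)
  -- A shift by the diameter of a ball containing `Ω` carries `Ω` off itself, so `φ (x + z) = 0` for
  -- `x ∈ Ω`.
  let z : Space N := EuclideanSpace.single ⟨0, hN⟩ (2 * |R|)
  have hz : ‖z‖ = 2 * |R| := by simp [z]
  refine ⟨‖z‖₊ ^ 2, fun φ h => ?_⟩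
  have key := lintegral_enorm_translate_sub_sq_le volume h.contDiff_one z
  rw [h.lintegral_fderiv] at key
  refine le_trans ?_ (key.trans_eq (by simp [enorm_eq_nnnorm]))
  calc ∫⁻ x in Ω, ‖φ x‖ₑ ^ 2 ≤ ∫⁻ x in Ω, ‖φ (x + z) - φ x‖ₑ ^ 2 := by
        refine setLIntegral_mono' hΩ.measurableSet fun x hx => ?_
        have h1 : ‖x‖ < |R| := by simpa using (hR hx).trans_le (le_abs_self R)
        have h2 : x + z ∉ Ω := by
          intro h3
          have h4 : ‖x + z‖ < |R| := by simpa using (hR h3).trans_le (le_abs_self R)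
          have h5 := norm_sub_le (x + z) x
          rw [add_sub_cancel_left] at h5
          linarith
        rw [h.eq_zero h2, zero_sub, enorm_neg]
    _ ≤ _ := setLIntegral_le_lintegral _ _

end

/-! ### The Sobolev inequality for test functions. -/

section

variable {N : ℕ} {Ω : Set (Space N)} {φ : Space N → ℝ}

theorem IsTestFunction.eLpNorm_fderiv (h : IsTestFunction Ω φ) (hΩ : MeasurableSet Ω) (p : ℝ≥0∞) :
    eLpNorm (fderiv ℝ φ) p volume = eLpNorm (∇ φ) p (vol Ω) := by
  rw [← eLpNorm_indicator_eq_eLpNorm_restrict hΩ]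
  refine eLpNorm_congr_enorm_ae (.of_forall fun x => ?_)
  by_cases hx : x ∈ Ω
  · simp [hx, enorm_gradient]
  · simp [hx, h.enorm_fderiv_eq_zero hx]

theorem IsTestFunction.aestronglyMeasurable_gradient (h : IsTestFunction Ω φ) (μ : Measure (Space N)) :
    AEStronglyMeasurable (∇ φ) μ := by
  have : Continuous (∇ φ) := (LinearIsometryEquiv.continuous _).comp
    (h.contDiff_one.continuous_fderiv (by simp))
  exact this.aestronglyMeasurable

/-- Integrate the derivative over a half-line. This covers `N = 1`, where no Gagliardo–Nirenberg
exponent `1 ≤ p < N` exists. -/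
theorem IsTestFunction.enorm_le_of_dim_one {Ω : Set (Space 1)} {φ : Space 1 → ℝ}
    (h : IsTestFunction Ω φ) (x : Space 1) : ‖φ x‖ₑ ≤ eLpNorm (fderiv ℝ φ) 1 volume := by
  let e : ℝ ≃ₗᵢ[ℝ] Space 1 := (OrthonormalBasis.singleton (Fin 1) ℝ).repr
  have hd : ∀ t, deriv (fun t => φ (e t)) t = fderiv ℝ φ (e t) (e 1) := fun t =>
    ((h.contDiff_one.differentiable (by simp) _).hasFDerivAt.comp_hasDerivAt t
      (by simpa using e.toContinuousLinearEquiv.toContinuousLinearMap.hasDerivAt)).deriv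
  have h1 := HasCompactSupport.enorm_le_lintegral_Ici_deriv (f := fun t => φ (e t))
    (h.contDiff_one.comp e.contDiff) (h.compact.comp_homeomorph e.toHomeomorph) (e.symm x)
  rw [e.apply_symm_apply] at h1
  refine h1.trans ((setLIntegral_le_lintegral _ _).trans ?_)
  rw [eLpNorm_one_eq_lintegral_enorm,
    ← e.measurePreserving.lintegral_comp_emb e.toHomeomorph.measurableEmbedding]
  refine lintegral_mono fun t => ?_
  rw [hd]
  refine (ContinuousLinearMap.le_opENorm _ _).trans_eq ?_
  rw [LinearIsometryEquiv.enorm_map]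
  simp

/-- The **Sobolev inequality** `‖φ‖_{L⁴} ≤ C ‖∇φ‖_{L²}` for test functions on a bounded set, in
dimension at most `4`. -/
theorem exists_eLpNorm_four_test_le (hN : 1 ≤ N) (hN' : N ≤ 4) (hΩ : IsOpen Ω)
    (hΩb : Bornology.IsBounded Ω) :
    ∃ C : ℝ≥0, ∀ φ : Space N → ℝ, IsTestFunction Ω φ →
      eLpNorm φ 4 (vol Ω) ≤ C * eLpNorm (∇ φ) 2 (vol Ω) := by
  have hvol : volume Ω ≠ ⊤ := hΩb.measure_lt_top.ne
  -- Hölder on the finite-measure set `Ω` lets the gradient be estimated first in any `Lᵖ` with `p ≤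
  -- 2`.
  have lower : ∀ p : ℝ≥0∞, p ≠ 0 → p ≤ 2 → ∃ D : ℝ≥0, ∀ φ : Space N → ℝ, IsTestFunction Ω φ →
      eLpNorm (fderiv ℝ φ) p volume ≤ D * eLpNorm (∇ φ) 2 (vol Ω) := by
    intro p hp0 hp
    have hpt : p ≠ ⊤ := (hp.trans_lt (by simp)).ne
    have hexp : 0 ≤ 1 / p.toReal - 1 / (2 : ℝ≥0∞).toReal := by
      rw [sub_nonneg]
      exact one_div_le_one_div_of_le (ENNReal.toReal_pos hp0 hpt)
        (ENNReal.toReal_mono (by simp) hp)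
    refine ⟨(volume Ω ^ (1 / p.toReal - 1 / (2 : ℝ≥0∞).toReal)).toNNReal, fun φ h => ?_⟩
    rw [h.eLpNorm_fderiv hΩ.measurableSet, ENNReal.coe_toNNReal
      (ENNReal.rpow_ne_top_of_nonneg hexp hvol), mul_comm]
    simpa using eLpNorm_le_eLpNorm_mul_rpow_measure_univ hp
      (h.aestronglyMeasurable_gradient (vol Ω))
  have gns : ∀ p : ℝ≥0, 1 ≤ p → p ≤ 2 → (p : ℝ) < N → (p : ℝ)⁻¹ - (N : ℝ)⁻¹ ≤ 4⁻¹ →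
      ∃ C : ℝ≥0, ∀ φ : Space N → ℝ, IsTestFunction Ω φ →
        eLpNorm φ 4 (vol Ω) ≤ C * eLpNorm (∇ φ) 2 (vol Ω) := by
    intro p hp1 hp2 hpN hpq
    obtain ⟨D, hD⟩ := lower p (by positivity) (by exact_mod_cast hp2)
    refine ⟨eLpNormLESNormFDerivOfLeConst ℝ volume Ω p 4 * D, fun φ h => ?_⟩
    have h1 := eLpNorm_le_eLpNorm_fderiv_of_le (volume : Measure (Space N)) (F := ℝ) (u := φ)
      (s := Ω) (p := p) (q := 4) h.contDiff_one ((subset_tsupport φ).trans h.support) hp1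
      (by rw [finrank_euclideanSpace_fin]; exact_mod_cast hpN)
      (by rw [finrank_euclideanSpace_fin]; simpa using hpq) hΩb
    calc eLpNorm φ 4 (vol Ω) ≤ eLpNorm φ 4 volume := eLpNorm_restrict_le _ _ _ _
      _ ≤ _ := h1
      _ ≤ eLpNormLESNormFDerivOfLeConst ℝ volume Ω p 4 * (D * eLpNorm (∇ φ) 2 (vol Ω)) := by
        gcongr; exact hD φ h
      _ = _ := by push_cast; ring
  obtain rfl | rfl | hN2 : N = 1 ∨ N = 2 ∨ 3 ≤ N := by omega
  · obtain ⟨D, hD⟩ := lower 1 (by simp) (by norm_num)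
    refine ⟨(volume Ω ^ (1 / 4 : ℝ)).toNNReal * D, fun φ h => ?_⟩
    have h1 : eLpNorm φ ⊤ (vol Ω) ≤ eLpNorm (fderiv ℝ φ) 1 volume := by
      rw [eLpNorm_exponent_top]
      exact eLpNormEssSup_le_of_ae_enorm_bound (.of_forall h.enorm_le_of_dim_one)
    calc eLpNorm φ 4 (vol Ω) ≤ eLpNorm φ ⊤ (vol Ω) * volume Ω ^ (1 / 4 : ℝ) := by
          simpa using eLpNorm_le_eLpNorm_mul_rpow_measure_univ (μ := vol Ω) (p := 4) le_top
            h.smooth.continuous.aestronglyMeasurable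
      _ ≤ (D * eLpNorm (∇ φ) 2 (vol Ω)) * volume Ω ^ (1 / 4 : ℝ) := by
          gcongr; exact h1.trans (hD φ h)
      _ = _ := by
          rw [ENNReal.coe_mul, ENNReal.coe_toNNReal
            (ENNReal.rpow_ne_top_of_nonneg (by norm_num) hvol)]
          ring
  -- For `N = 2` the exponent 2 violates `p < N`; `4/3` is critical, as `3/4 - 1/2 = 1/4`.
  · refine gns (4 / 3) ?_ ?_ ?_ ?_
    · rw [le_div_iff₀ (by norm_num)]; norm_num
    · rw [div_le_iff₀ (by norm_num)]; norm_num
    · push_cast; norm_num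
    · push_cast; norm_num
  -- Here `1/2 - 1/N ≤ 1/4` is exactly `N ≤ 4`.
  · refine gns 2 (by norm_num) le_rfl ?_ ?_
    · have : (3 : ℝ) ≤ N := by exact_mod_cast hN2
      push_cast; linarith
    · have : (4 : ℝ)⁻¹ ≤ (N : ℝ)⁻¹ := inv_anti₀ (by positivity) (by exact_mod_cast hN')
      push_cast; linarith

end

/-! ### Finite-rank averaging operators and their error on test functions. -/

section

variable {N : ℕ} {Ω : Set (Space N)} {φ : Space N → ℝ}

theorem isCompactOperator_innerSL_smulRight {F G : Type*} [NormedAddCommGroup F]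
    [InnerProductSpace ℝ F] [NormedAddCommGroup G] [NormedSpace ℝ G] (a : F) (b : G) :
    IsCompactOperator ((innerSL ℝ a).smulRight b) := by
  have h := (isCompactOperator_of_locallyCompactSpace_rng
    (ContinuousLinearMap.toSpanSingleton ℝ b)).comp_clm (innerSL ℝ a)
  exact h

theorem isCompactOperator_sum {ι F G : Type*} [NormedAddCommGroup F] [NormedSpace ℝ F]
    [NormedAddCommGroup G] [NormedSpace ℝ G] (s : Finset ι) (T : ι → F →L[ℝ] G)
    (h : ∀ i, IsCompactOperator (T i)) :
    IsCompactOperator (∑ i ∈ s, T i : F →L[ℝ] G) := by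
  classical
  induction s using Finset.induction_on with
  | empty => simpa using isCompactOperator_zero
  | insert i s hi ih => rw [Finset.sum_insert hi]; exact (h i).add ih

/-- A finite-rank operator on `L²(Ω)` that replaces a function near a point by its average over a
ball of radius `h` with that point in it. -/
theorem exists_averaging_operator (hΩ : IsOpen Ω) (hΩb : Bornology.IsBounded Ω) {h : ℝ}
    (hh : 0 < h) :
    ∃ F : Lp ℝ 2 (vol Ω) →L[ℝ] Lp ℝ 2 (vol Ω), IsCompactOperator F ∧
      ∀ f : Lp ℝ 2 (vol Ω), ∀ᵐ x ∂(vol Ω), ∃ c : Space N, x ∈ Metric.ball c h ∧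
        F f x = (volume.real (Metric.ball c h))⁻¹ * ∫ y in Metric.ball c h ∩ Ω, f y := by
  have : IsFiniteMeasure (vol Ω) := ⟨by simpa using hΩb.measure_lt_top⟩
  set c : ℕ → Space N := TopologicalSpace.denseSeq (Space N)
  obtain ⟨t, ht⟩ := hΩb.isCompact_closure.elim_finite_subcover
    (fun k => Metric.ball (c k) h) (fun k => Metric.isOpen_ball) fun x _ => by
      obtain ⟨k, hk⟩ := (TopologicalSpace.denseRange_denseSeq (Space N)).exists_dist_lt x hh
      exact Set.mem_iUnion.2 ⟨k, hk⟩
  let B : ℕ → Set (Space N) := fun k => Metric.ball (c k) h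
  have hB : ∀ k, MeasurableSet (B k) := fun k => measurableSet_ball
  have hQ : ∀ k, MeasurableSet (disjointed B k) := fun k => MeasurableSet.disjointed hB k
  -- Each `disjointed B k` depends on all earlier balls, so every index up to the largest one in `t`
  -- is kept.
  let n := t.sup id + 1
  have hcov : ∀ x ∈ Ω, ∃ k ∈ Finset.range n, x ∈ disjointed B k := by
    intro x hx
    obtain ⟨k, hk, hxk⟩ := Set.mem_iUnion₂.1 (ht (subset_closure hx))
    have hx' : x ∈ ⋃ i ∈ Finset.range (t.sup id + 1), disjointed B i := by
      rw [biUnion_range_succ_disjointed, partialSups_eq_biSup]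
      exact Set.mem_iUnion₂.2 ⟨k, Finset.le_sup (f := id) hk, hxk⟩
    simpa [n] using hx'
  let a : ℕ → Lp ℝ 2 (vol Ω) := fun k => indicatorConstLp 2 (hB k) (measure_ne_top (vol Ω) _) 1
  let b : ℕ → Lp ℝ 2 (vol Ω) := fun k => indicatorConstLp 2 (hQ k) (measure_ne_top (vol Ω) _)
    ((volume.real (B k))⁻¹)
  -- On the `k`-th piece of the partition the value is the integral of `f` over the `k`-th ball,
  -- intersected with `Ω`, divided by the volume of the whole ball. This is the right average for
  -- functions extended by zero.
  refine ⟨∑ k ∈ Finset.range n, (innerSL ℝ (a k)).smulRight (b k),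
    isCompactOperator_sum _ _ fun k => isCompactOperator_innerSL_smulRight _ _, fun f => ?_⟩
  have hsum : (∑ k ∈ Finset.range n, (innerSL ℝ (a k)).smulRight (b k)) f =
      ∑ k ∈ Finset.range n, (inner ℝ (a k) f) • b k := by
    simp
  rw [hsum]
  have hsm : ∀ᵐ x ∂(vol Ω), ∀ k, (inner ℝ (a k) f • b k : Lp ℝ 2 (vol Ω)) x =
      inner ℝ (a k) f * (disjointed B k).indicator (fun _ => (volume.real (B k))⁻¹) x := by
    rw [ae_all_iff]
    intro k
    filter_upwards [Lp.coeFn_smul (inner ℝ (a k) f) (b k), indicatorConstLp_coeFn (p := 2)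
      (hs := hQ k) (hμs := measure_ne_top (vol Ω) _) (c := (volume.real (B k))⁻¹)] with x h1 h2
    rw [h1, Pi.smul_apply, h2, smul_eq_mul]
  filter_upwards [Lp.coeFn_fun_finsetSum (Finset.range n) fun k => inner ℝ (a k) f • b k, hsm,
    ae_restrict_mem hΩ.measurableSet] with x h1 h2 hx
  obtain ⟨k, hk, hxk⟩ := hcov x hx
  refine ⟨c k, disjointed_subset B k hxk, ?_⟩
  rw [h1, Finset.sum_eq_single_of_mem k hk, h2, Set.indicator_of_mem hxk, mul_comm]
  · congr 1
    rw [L2.inner_indicatorConstLp_one, Measure.restrict_restrict (hB k)]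
  · intro j _ hj
    rw [h2, Set.indicator_of_notMem, mul_zero]
    exact fun hxj => (disjoint_disjointed B hj).le_bot ⟨hxj, hxk⟩

/-- The difference is the average of `φ x - φ y`, to which Cauchy–Schwarz applies. Points of the
ball lie within `2 * h` of `x`, so substituting `y = x + z` gives a bound free of the center `c`,
which will vary with `x`. -/
theorem enorm_sub_average_sq_le {φ : Space N → ℝ} (hφ : Continuous φ) {h : ℝ} (hh : 0 < h)
    {c x : Space N} (hx : x ∈ Metric.ball c h) :
    ‖φ x - (volume.real (Metric.ball c h))⁻¹ * ∫ y in Metric.ball c h, φ y‖ₑ ^ 2 ≤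
      (volume (Metric.ball (0 : Space N) h))⁻¹ *
        ∫⁻ z in Metric.ball (0 : Space N) (2 * h), ‖φ (x + z) - φ x‖ₑ ^ 2 := by
  have hv0 : volume (Metric.ball c h) ≠ 0 := (Metric.measure_ball_pos _ _ hh).ne'
  have hvt : volume (Metric.ball c h) ≠ ⊤ := measure_ball_lt_top.ne
  have hr : volume.real (Metric.ball c h) ≠ 0 := (ENNReal.toReal_pos hv0 hvt).ne'
  have hint : IntegrableOn φ (Metric.ball c h) :=
    (hφ.continuousOn.integrableOn_compact (isCompact_closedBall c h)).mono_set
      Metric.ball_subset_closedBall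
  have h1 : φ x - (volume.real (Metric.ball c h))⁻¹ * ∫ y in Metric.ball c h, φ y =
      (volume.real (Metric.ball c h))⁻¹ * ∫ y in Metric.ball c h, (φ x - φ y) := by
    have hc : IntegrableOn (fun _ => φ x) (Metric.ball c h) := integrableOn_const hvt
    rw [integral_sub hc hint, setIntegral_const, smul_eq_mul, mul_sub, inv_mul_cancel_left₀ hr]
  have h2 : ‖(volume.real (Metric.ball c h))⁻¹‖ₑ = (volume (Metric.ball c h))⁻¹ := by
    rw [enorm_inv hr, Measure.real, Real.enorm_of_nonneg ENNReal.toReal_nonneg,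
      ENNReal.ofReal_toReal hvt]
  have h3 : volume (Metric.ball c h) = volume (Metric.ball (0 : Space N) h) :=
    Measure.addHaar_ball_center _ _ _
  have hm : Measurable fun y => ‖φ y - φ x‖ₑ ^ 2 := by fun_prop
  rw [h1, enorm_mul, h2, mul_pow]
  calc _ ≤ (volume (Metric.ball c h))⁻¹ ^ 2 *
        (∫⁻ y in Metric.ball c h, ‖φ y - φ x‖ₑ) ^ 2 := by
        gcongr
        refine (enorm_integral_le_lintegral_enorm _).trans_eq (lintegral_congr fun y => ?_)
        rw [← enorm_neg, neg_sub]
    _ ≤ (volume (Metric.ball c h))⁻¹ ^ 2 * (volume (Metric.ball c h) *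
        ∫⁻ y in Metric.ball c h, ‖φ y - φ x‖ₑ ^ 2) := by
        gcongr
        simpa using sq_lintegral_le (μ := volume.restrict (Metric.ball c h))
          (f := fun y => ‖φ y - φ x‖ₑ) (by fun_prop)
    _ = (volume (Metric.ball c h))⁻¹ * ∫⁻ y in Metric.ball c h, ‖φ y - φ x‖ₑ ^ 2 := by
        rw [pow_two, mul_assoc, ← mul_assoc _ (volume (Metric.ball c h)),
          ENNReal.inv_mul_cancel hv0 hvt, one_mul]
    _ ≤ _ := by
        rw [h3]
        refine mul_le_mul_right ?_ _
        rw [← lintegral_indicator measurableSet_ball, ← lintegral_indicator measurableSet_ball,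
          ← lintegral_add_left_eq_self _ x]
        refine lintegral_mono fun z => ?_
        by_cases hz : x + z ∈ Metric.ball c h
        · have : z ∈ Metric.ball (0 : Space N) (2 * h) := by
            have h5 : dist (x + z) x < 2 * h := by
              have := dist_triangle_right (x + z) x c
              rw [Metric.mem_ball] at hz hx
              linarith
            simpa [dist_eq_norm] using h5
          simp [hz, this]
        · simp [hz]

/-- Tonelli and the translation estimate with `‖z‖ ≤ 2 * h`; the factor `2 ^ N` is the volume ratio
of the two balls. -/
theorem lintegral_ball_translate_le (hφ : ContDiff ℝ 1 φ) {h : ℝ} (hh : 0 < h) :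
    ∫⁻ x, (volume (Metric.ball (0 : Space N) h))⁻¹ *
        ∫⁻ z in Metric.ball (0 : Space N) (2 * h), ‖φ (x + z) - φ x‖ₑ ^ 2 ≤
      ENNReal.ofReal (2 ^ N * (2 * h) ^ 2) * ∫⁻ x, ‖fderiv ℝ φ x‖ₑ ^ 2 := by
  set v := volume (Metric.ball (0 : Space N) h) with hv
  have hv0 : v ≠ 0 := (Metric.measure_ball_pos _ _ hh).ne'
  have hvt : v ≠ ⊤ := measure_ball_lt_top.ne
  have hφc := hφ.continuous
  have hm : Measurable (Function.uncurry fun x z : Space N => ‖φ (x + z) - φ x‖ₑ ^ 2) := by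
    unfold Function.uncurry
    fun_prop
  have h2 : volume (Metric.ball (0 : Space N) (2 * h)) = ENNReal.ofReal (2 ^ N) * v := by
    have := Measure.addHaar_ball_mul_of_pos (volume : Measure (Space N)) 0 (two_pos) h
    rwa [finrank_euclideanSpace_fin] at this
  calc _ = v⁻¹ * ∫⁻ z in Metric.ball (0 : Space N) (2 * h), (∫⁻ x, ‖φ (x + z) - φ x‖ₑ ^ 2) := by
        rw [lintegral_const_mul' _ _ (ENNReal.inv_ne_top.2 hv0),
          lintegral_lintegral_swap hm.aemeasurable]
    _ ≤ v⁻¹ * ∫⁻ _ in Metric.ball (0 : Space N) (2 * h),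
          ENNReal.ofReal ((2 * h) ^ 2) * ∫⁻ x, ‖fderiv ℝ φ x‖ₑ ^ 2 := by
        gcongr v⁻¹ * ?_
        refine setLIntegral_mono' measurableSet_ball fun z hz => ?_
        refine (lintegral_enorm_translate_sub_sq_le volume hφ z).trans ?_
        gcongr
        rw [ENNReal.ofReal_pow (by positivity), ← ofReal_norm]
        gcongr
        exact (mem_ball_zero_iff.1 hz).le
    _ = _ := by
        rw [setLIntegral_const, h2, ENNReal.ofReal_mul (by positivity)]
        calc _ = (v⁻¹ * v) * (ENNReal.ofReal (2 ^ N) * ENNReal.ofReal ((2 * h) ^ 2) *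
              ∫⁻ x, ‖fderiv ℝ φ x‖ₑ ^ 2) := by ring
          _ = _ := by rw [ENNReal.inv_mul_cancel hv0 hvt, one_mul]

theorem IsTestFunction.lintegral_sub_le_of_average (hφ : IsTestFunction Ω φ) (hΩ : IsOpen Ω)
    {h : ℝ} (hh : 0 < h) {f F : Space N → ℝ} (hf : f =ᵐ[vol Ω] φ)
    (hF : ∀ᵐ x ∂(vol Ω), ∃ c : Space N, x ∈ Metric.ball c h ∧
        F x = (volume.real (Metric.ball c h))⁻¹ * ∫ y in Metric.ball c h ∩ Ω, f y) :
    ∫⁻ x in Ω, ‖f x - F x‖ₑ ^ 2 ≤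
      ENNReal.ofReal (2 ^ N * (2 * h) ^ 2) * ∫⁻ x in Ω, ‖∇ φ x‖ₑ ^ 2 := by
  rw [← hφ.lintegral_fderiv]
  refine le_trans ?_ (lintegral_ball_translate_le hφ.contDiff_one hh)
  refine le_trans (lintegral_mono_ae ?_) (setLIntegral_le_lintegral Ω _)
  filter_upwards [hf, hF] with x hx ⟨c, hc, hFx⟩
  have h1 : ∫ y in Metric.ball c h ∩ Ω, f y = ∫ y in Metric.ball c h, φ y := by
    rw [setIntegral_congr_ae₀ (g := φ) (measurableSet_ball.inter hΩ.measurableSet).nullMeasurableSet]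
    · exact (setIntegral_eq_of_subset_of_forall_sdiff_eq_zero measurableSet_ball
        Set.inter_subset_left fun y hy => hφ.eq_zero fun hy' => hy.2 ⟨hy.1, hy'⟩).symm
    · filter_upwards [(ae_restrict_iff' hΩ.measurableSet).1 hf] with y hy hy'
      exact hy hy'.2
  rw [hFx, h1, hx]
  exact enorm_sub_average_sq_le hφ.smooth.continuous hh hc

end

/-! ### Coercivity and Rayleigh quotients for abstract forms. -/

section

section Forms

variable {V W : Type*} [NormedAddCommGroup V] [NormedSpace ℝ V]
  [NormedAddCommGroup W]

/-- A positive form that is coercive up to a compact term is coercive. -/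
theorem exists_coercive_of_compact [CompleteSpace V] [NormedSpace ℝ W]
    (B : V →L[ℝ] V →L[ℝ] ℝ)
    (J : V →L[ℝ] W) (hJ : IsCompactOperator J)
    (hpos : ∀ v, v ≠ 0 → 0 < B v v) {c C : ℝ} (hc : 0 < c)
    (hcC : ∀ v, c * ‖v‖ ^ 2 ≤ B v v + C * ‖J v‖ ^ 2) :
    ∃ c' : ℝ, 0 < c' ∧ ∀ v, c' * ‖v‖ ^ 2 ≤ B v v := by
  by_contra! hcon
  have hnn : ∀ v, 0 ≤ B v v := fun v => by
    by_cases hv : v = 0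
    · simp [hv]
    · exact (hpos v hv).le
  have hunit : ∀ n : ℕ, ∃ v : V, ‖v‖ = 1 ∧ B v v < 1 / ((n : ℝ) + 1) := by
    intro n
    obtain ⟨v, hv⟩ := hcon (1 / ((n : ℝ) + 1)) (by positivity)
    have hv0 : v ≠ 0 := by rintro rfl; simp at hv
    have hn : 0 < ‖v‖ := norm_pos_iff.2 hv0
    refine ⟨‖v‖⁻¹ • v, by simp [norm_smul, hn.ne'], ?_⟩
    simp only [map_smul, smul_apply, smul_eq_mul]
    calc ‖v‖⁻¹ * (‖v‖⁻¹ * B v v) = B v v / ‖v‖ ^ 2 := by field_simp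
      _ < _ := by rw [div_lt_iff₀ (by positivity)]; exact hv
  choose v hv1 hvB using hunit
  obtain ⟨K, hK, hJK⟩ := IsCompactOperator.image_closedBall_subset_compact
    (f := (J : V →ₗ[ℝ] W)) hJ 1
  obtain ⟨w, -, θ, hθ, hw⟩ := hK.tendsto_subseq (x := fun n => J (v n)) fun n =>
    hJK ⟨v n, by simp [hv1], rfl⟩
  have hb : Tendsto (fun n => B (v (θ n)) (v (θ n))) atTop (𝓝 0) :=
    (squeeze_zero (fun n => hnn _) (fun n => (hvB n).le)
      tendsto_one_div_add_atTop_nhds_zero_nat).comp hθ.tendsto_atTop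
  -- The unit vectors `v n` have `B (v n) (v n) → 0`, and `J (v n)` converges along `θ`. Coercivity
  -- up to `J`, applied to differences, gives convergence in `V` itself; the limit is a unit
  -- isotropic vector.
  have hcauchy : CauchySeq fun n => v (θ n) := by
    rw [cauchySeq_iff_tendsto_dist_atTop_0]
    have hJc := cauchySeq_iff_tendsto_dist_atTop_0.1 hw.cauchySeq
    have hlim : Tendsto (fun p : ℕ × ℕ => Real.sqrt ((2 * B (v (θ p.1)) (v (θ p.1)) +
        2 * B (v (θ p.2)) (v (θ p.2)) + C * dist (J (v (θ p.1))) (J (v (θ p.2))) ^ 2) / c))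
        atTop (𝓝 0) := by
      rw [← prod_atTop_atTop_eq] at hJc ⊢
      have h := (((((hb.comp tendsto_fst).const_mul 2).add
        ((hb.comp tendsto_snd).const_mul 2)).add ((hJc.pow 2).const_mul C)).div_const c).sqrt
      simpa using h
    refine squeeze_zero (fun _ => dist_nonneg) (fun p => Real.le_sqrt_of_sq_le ?_) hlim
    rw [le_div_iff₀ hc, dist_eq_norm, dist_eq_norm, ← map_sub, mul_comm]
    refine (hcC _).trans (add_le_add_left ?_ _)
    -- The parallelogram law bounds `B` at the difference by twice the sum of its values.
    have h1 := hnn (v (θ p.1) + v (θ p.2))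
    simp only [map_add, map_sub, add_apply,
      sub_apply] at h1 ⊢
    linarith
  obtain ⟨u, hu⟩ := cauchySeq_tendsto_of_complete hcauchy
  have hu1 : ‖u‖ = 1 := by
    have h := hu.norm
    simp only [hv1] at h
    exact tendsto_nhds_unique h tendsto_const_nhds
  have huB : B u u = 0 :=
    tendsto_nhds_unique
      (((show Continuous fun v => B v v by fun_prop).tendsto u).comp hu) hb
  exact (hpos u (by rintro rfl; simp at hu1)).ne' huB

/-- For a positive semidefinite symmetric form, isotropic vectors are in the radical. -/
theorem eq_zero_of_isotropic (B : V →L[ℝ] V →L[ℝ] ℝ) (hsymm : ∀ v w, B v w = B w v)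
    (hnn : ∀ v, 0 ≤ B v v) {u : V} (hu : B u u = 0) (w : V) : B u w = 0 := by
  have key : ∀ t : ℝ, 0 ≤ B w w + 2 * t * B u w := fun t => by
    have h := hnn (w + t • u)
    simp only [map_add, map_smul, add_apply, smul_apply,
      smul_eq_mul, hu, hsymm w u] at h
    linarith
  by_contra h0
  -- In `key` the term quadratic in `t` is gone because `u` is isotropic; this `t` makes the
  -- remaining affine function equal to `-1`.
  have h1 := key (-(B w w + 1) / (2 * B u w))
  have h2 : 2 * (-(B w w + 1) / (2 * B u w)) * B u w = -(B w w + 1) := by field_simp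
  rw [h2] at h1
  linarith

/-- The Rayleigh quotient `A v v / ‖J v‖²` of a coercive form attains its minimum at an
eigenvector, if `J` is compact. -/
theorem exists_rayleigh_minimizer [CompleteSpace V] [InnerProductSpace ℝ W]
    (A : V →L[ℝ] V →L[ℝ] ℝ)
    (hsymm : ∀ v w, A v w = A w v) {c : ℝ} (hc : 0 < c) (hA : ∀ v, c * ‖v‖ ^ 2 ≤ A v v)
    (J : V →L[ℝ] W) (hJ : IsCompactOperator J) {v₀ : V} (hv₀ : J v₀ ≠ 0) :
    ∃ μ : ℝ, (∃ u, u ≠ 0 ∧ ∀ w, A u w = μ * inner ℝ (J u) (J w)) ∧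
      ∀ v, μ * ‖J v‖ ^ 2 ≤ A v v := by
  let S : Set ℝ := {t | ∀ v, t * ‖J v‖ ^ 2 ≤ A v v}
  have hAnn : ∀ v, 0 ≤ A v v := fun v => le_trans (by positivity) (hA v)
  have h0 : (0 : ℝ) ∈ S := fun v => by simpa using hAnn v
  have hub : ∀ v, J v ≠ 0 → ∀ t ∈ S, t ≤ A v v / ‖J v‖ ^ 2 := fun v hv t ht => by
    rw [le_div_iff₀ (pow_pos (norm_pos_iff.2 hv) 2)]; exact ht v
  have hbdd : BddAbove S := ⟨_, hub v₀ hv₀⟩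
  have hμ : ∀ v, sSup S * ‖J v‖ ^ 2 ≤ A v v := fun v => by
    by_cases hv : J v = 0
    · simpa [hv] using hAnn v
    · rw [← le_div_iff₀ (pow_pos (norm_pos_iff.2 hv) 2)]
      exact csSup_le ⟨0, h0⟩ (hub v hv)
  refine ⟨sSup S, ?_, hμ⟩
  let D : V →L[ℝ] V →L[ℝ] ℝ := (innerSL ℝ).bilinearComp J J
  have hD : ∀ v w, D v w = inner ℝ (J v) (J w) := fun v w => rfl
  let B := A - sSup S • D
  have hB : ∀ v w, B v w = A v w - sSup S * inner ℝ (J v) (J w) := fun v w => rfl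
  have hBv : ∀ v, B v v = A v v - sSup S * ‖J v‖ ^ 2 := fun v => by
    rw [hB, real_inner_self_eq_norm_sq]
  have hBnn : ∀ v, 0 ≤ B v v := fun v => by rw [hBv]; linarith [hμ v]
  -- If `B` were positive definite it would be coercive, and `sSup S` could be raised. Hence `B` has
  -- a nonzero isotropic vector, which lies in the radical: this is the eigenvector equation.
  by_cases hpos : ∀ v, v ≠ 0 → 0 < B v v
  · obtain ⟨c', hc', hcB⟩ := exists_coercive_of_compact B J hJ hpos hc (C := sSup S)
      fun v => by rw [hBv]; linarith [hA v]
    exfalso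
    have hmem : sSup S + c' / (‖J‖ ^ 2 + 1) ∈ S := fun v => by
      have h1 := hcB v
      rw [hBv] at h1
      have h2 : c' / (‖J‖ ^ 2 + 1) * ‖J v‖ ^ 2 ≤ c' * ‖v‖ ^ 2 := by
        rw [div_mul_eq_mul_div, div_le_iff₀ (by positivity)]
        have h3 : ‖J v‖ ^ 2 ≤ (‖J‖ * ‖v‖) ^ 2 := by gcongr; exact J.le_opNorm v
        have h4 : ‖J v‖ ^ 2 ≤ ‖v‖ ^ 2 * (‖J‖ ^ 2 + 1) := by nlinarith [sq_nonneg ‖v‖]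
        calc _ ≤ c' * (‖v‖ ^ 2 * (‖J‖ ^ 2 + 1)) := by gcongr
          _ = _ := by ring
      linarith
    have h5 := le_csSup hbdd hmem
    have h6 : 0 < c' / (‖J‖ ^ 2 + 1) := by positivity
    linarith
  · push Not at hpos
    obtain ⟨u, hu0, hu⟩ := hpos
    refine ⟨u, hu0, fun w => ?_⟩
    have h := eq_zero_of_isotropic B (fun v w => by
      rw [hB, hB, hsymm v w, real_inner_comm]) hBnn (le_antisymm hu (hBnn u)) w
    rw [hB] at h
    linarith

end Forms

end

/-! ### Poincaré, Rellich, weak gradients and Sobolev on `H01 Ω`. -/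

section

variable {N : ℕ} {Ω : Set (Space N)}

instance instCompleteSpaceH01 : CompleteSpace (H01 Ω) :=
  (testPairs Ω).isClosed_topologicalClosure.completeSpace_coe

/-- The inclusion `H_0^1(Ω) → L²(Ω)`. -/
def toL2 (Ω : Set (Space N)) : H01 Ω →L[ℝ] Lp ℝ 2 (vol Ω) :=
  (WithLp.fstL 2 ℝ (Lp ℝ 2 (vol Ω)) (Lp (Space N) 2 (vol Ω))).comp (H01 Ω).subtypeL

/-- The weak gradient as an operator `H_0^1(Ω) → L²(Ω; ℝ^N)`. -/
def gradL2 (Ω : Set (Space N)) : H01 Ω →L[ℝ] Lp (Space N) 2 (vol Ω) :=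
  (WithLp.sndL 2 ℝ (Lp ℝ 2 (vol Ω)) (Lp (Space N) 2 (vol Ω))).comp (H01 Ω).subtypeL

theorem coe_toL2 (u : H01 Ω) : (toL2 Ω u : Space N → ℝ) = fn u := rfl

theorem coe_gradL2 (u : H01 Ω) : (gradL2 Ω u : Space N → Space N) = grad u := rfl

theorem norm_sq_H01 (u : H01 Ω) : ‖u‖ ^ 2 = ‖toL2 Ω u‖ ^ 2 + ‖gradL2 Ω u‖ ^ 2 :=
  WithLp.prod_norm_sq_eq_of_L2 (u : L2Pair Ω)

/-- The density argument that transfers each estimate from test functions to their closure. -/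
theorem H01_induction {P : L2Pair Ω → Prop} (hP : IsClosed {p | P p})
    (h : ∀ p φ, IsTestFunction Ω φ → p.fst =ᵐ[vol Ω] φ → p.snd =ᵐ[vol Ω] ∇ φ → P p)
    (u : H01 Ω) : P u := by
  have h1 : closure (testPairs Ω : Set (L2Pair Ω)) ⊆ {p | P p} := by
    refine closure_minimal ?_ hP
    rintro p ⟨φ, hφ, h1, h2⟩
    exact h p φ hφ h1 h2
  exact h1 u.2

theorem enorm_sq_L2 {α F : Type*} [MeasurableSpace α] {μ : Measure α} [NormedAddCommGroup F]
    (f : Lp F 2 μ) : ‖f‖ₑ ^ 2 = ∫⁻ x, ‖f x‖ₑ ^ 2 ∂μ := by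
  have h := eLpNorm_nnreal_pow_eq_lintegral (f := f) (μ := μ) (p := 2) (by simp)
  rw [Lp.enorm_def]
  simpa using h

theorem norm_sq_le_of_lintegral_le {α F G : Type*} [MeasurableSpace α] {μ : Measure α}
    [NormedAddCommGroup F] [NormedAddCommGroup G] {f : Lp F 2 μ} {g : Lp G 2 μ} {C : ℝ}
    (hC : 0 ≤ C) (h : ∫⁻ x, ‖f x‖ₑ ^ 2 ∂μ ≤ ENNReal.ofReal C * ∫⁻ x, ‖g x‖ₑ ^ 2 ∂μ) :
    ‖f‖ ^ 2 ≤ C * ‖g‖ ^ 2 := by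
  rw [← enorm_sq_L2, ← enorm_sq_L2, ← ofReal_norm, ← ofReal_norm,
    ← ENNReal.ofReal_pow (norm_nonneg _), ← ENNReal.ofReal_pow (norm_nonneg _),
    ← ENNReal.ofReal_mul hC] at h
  exact (ENNReal.ofReal_le_ofReal_iff (by positivity)).1 h

/-- The **Poincaré inequality**. -/
theorem exists_poincare (hN : 1 ≤ N) (hΩ : IsOpen Ω) (hΩb : Bornology.IsBounded Ω) :
    ∃ C : ℝ, 0 ≤ C ∧ ∀ u : H01 Ω, ‖toL2 Ω u‖ ^ 2 ≤ C * ‖gradL2 Ω u‖ ^ 2 := by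
  obtain ⟨C, hC⟩ := exists_lintegral_test_sq_le hN hΩ hΩb
  refine ⟨C, C.2, fun u => H01_induction (P := fun p => ‖p.fst‖ ^ 2 ≤ C * ‖p.snd‖ ^ 2)
    ?_ (fun p φ hφ h1 h2 => ?_) u⟩
  · have c1 := (WithLp.fstL 2 ℝ (Lp ℝ 2 (vol Ω)) (Lp (Space N) 2 (vol Ω))).continuous
    have c2 := (WithLp.sndL 2 ℝ (Lp ℝ 2 (vol Ω)) (Lp (Space N) 2 (vol Ω))).continuous
    exact isClosed_le (c1.norm.pow 2) (continuous_const.mul (c2.norm.pow 2))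
  · refine norm_sq_le_of_lintegral_le C.2 ?_
    have e1 : ∫⁻ x in Ω, ‖p.fst x‖ₑ ^ 2 = ∫⁻ x in Ω, ‖φ x‖ₑ ^ 2 :=
      lintegral_congr_ae (h1.mono fun x hx => by simp only [hx])
    have e2 : ∫⁻ x in Ω, ‖p.snd x‖ₑ ^ 2 = ∫⁻ x in Ω, ‖∇ φ x‖ₑ ^ 2 :=
      lintegral_congr_ae (h2.mono fun x hx => by simp only [hx])
    rw [e1, e2]
    simpa using hC φ hφ

/-- The **Rellich theorem**: the inclusion `H_0^1(Ω) → L²(Ω)` is compact. -/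
theorem isCompactOperator_toL2 (hΩ : IsOpen Ω) (hΩb : Bornology.IsBounded Ω) :
    IsCompactOperator (toL2 Ω) := by
  have happ : ∀ n : ℕ, ∃ F : Lp ℝ 2 (vol Ω) →L[ℝ] Lp ℝ 2 (vol Ω), IsCompactOperator F ∧
      ∀ u : H01 Ω, ‖toL2 Ω u - F (toL2 Ω u)‖ ^ 2 ≤
        2 ^ N * (2 * (1 / ((n : ℝ) + 1))) ^ 2 * ‖gradL2 Ω u‖ ^ 2 := by
    intro n
    have hh : 0 < 1 / ((n : ℝ) + 1) := by positivity
    obtain ⟨F, hF, hFf⟩ := exists_averaging_operator hΩ hΩb hh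
    refine ⟨F, hF, fun u => H01_induction (P := fun p => ‖p.fst - F p.fst‖ ^ 2 ≤
      2 ^ N * (2 * (1 / ((n : ℝ) + 1))) ^ 2 * ‖p.snd‖ ^ 2) ?_ (fun p φ hφ h1 h2 => ?_) u⟩
    · have c1 := (WithLp.fstL 2 ℝ (Lp ℝ 2 (vol Ω)) (Lp (Space N) 2 (vol Ω))).continuous
      have c2 := (WithLp.sndL 2 ℝ (Lp ℝ 2 (vol Ω)) (Lp (Space N) 2 (vol Ω))).continuous
      exact isClosed_le ((c1.sub (F.continuous.comp c1)).norm.pow 2)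
        (continuous_const.mul (c2.norm.pow 2))
    · refine norm_sq_le_of_lintegral_le (by positivity) ?_
      have h3 := hφ.lintegral_sub_le_of_average hΩ hh h1 (hFf p.fst)
      have e1 : ∫⁻ x in Ω, ‖(p.fst - F p.fst : Lp ℝ 2 (vol Ω)) x‖ₑ ^ 2 =
          ∫⁻ x in Ω, ‖p.fst x - F p.fst x‖ₑ ^ 2 :=
        lintegral_congr_ae ((Lp.coeFn_sub p.fst (F p.fst)).mono fun x hx => by
          simp only [hx, Pi.sub_apply])
      have e2 : ∫⁻ x in Ω, ‖p.snd x‖ₑ ^ 2 = ∫⁻ x in Ω, ‖∇ φ x‖ₑ ^ 2 :=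
        lintegral_congr_ae (h2.mono fun x hx => by simp only [hx])
      rw [e1, e2]
      exact h3
  choose F hF hFu using happ
  -- The averaging error is of order `1 / (n + 1)` in operator norm, and norm limits of compact
  -- operators are compact.
  have hlim : Tendsto (fun n => (F n).comp (toL2 Ω)) atTop (𝓝 (toL2 Ω)) := by
    refine (tendsto_iff_norm_sub_tendsto_zero (E := H01 Ω →L[ℝ] Lp ℝ 2 (vol Ω))).2 ?_
    have h0 : Tendsto (fun n : ℕ => Real.sqrt (2 ^ N) * (2 * (1 / ((n : ℝ) + 1)))) atTop (𝓝 0) := by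
      simpa using (tendsto_one_div_add_atTop_nhds_zero_nat.const_mul 2).const_mul (Real.sqrt (2 ^ N))
    refine squeeze_zero (fun n => ContinuousLinearMap.opNorm_nonneg _) (fun n => ?_) h0
    refine ContinuousLinearMap.opNorm_le_bound _ (by positivity) fun u => ?_
    refine (sq_le_sq₀ (norm_nonneg _) (by positivity)).1 ?_
    rw [mul_pow, mul_pow, Real.sq_sqrt (by positivity)]
    calc _ = ‖toL2 Ω u - F n (toL2 Ω u)‖ ^ 2 := by rw [← norm_neg]; simp
      _ ≤ _ := hFu n u
      _ ≤ _ := by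
        gcongr
        refine (sq_le_sq₀ (norm_nonneg _) (norm_nonneg _)).1 ?_
        rw [norm_sq_H01]
        nlinarith [sq_nonneg ‖toL2 Ω u‖]
  exact isCompactOperator_of_tendsto hlim (.of_forall fun n => (hF n).comp_clm _)

theorem IsTestFunction.memLp {φ : Space N → ℝ} (h : IsTestFunction Ω φ) (p : ℝ≥0∞) :
    MemLp φ p (vol Ω) :=
  (h.smooth.continuous.memLp_of_hasCompactSupport h.compact).restrict Ω

theorem IsTestFunction.memLp_fderiv_apply {φ : Space N → ℝ} (h : IsTestFunction Ω φ)
    (e : Space N) (p : ℝ≥0∞) : MemLp (fun x => fderiv ℝ φ x e) p (vol Ω) :=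
  ((h.contDiff_one.continuous_fderiv (by simp)).clm_apply
    continuous_const).memLp_of_hasCompactSupport (h.compact.fderiv_apply ℝ e) |>.restrict Ω

/-- The second component of an element of `H_0^1(Ω)` is its weak gradient. -/
theorem integral_fn_mul_fderiv (u : H01 Ω) {ψ : Space N → ℝ}
    (hψ : IsTestFunction Ω ψ) (e : Space N) :
    ∫ x in Ω, fn u x * fderiv ℝ ψ x e = - ∫ x in Ω, inner ℝ e (grad u x) * ψ x := by
  -- Both integrals become `L²` inner products with fixed elements, so the identity is a closed
  -- condition.
  let a : Lp ℝ 2 (vol Ω) := (hψ.memLp_fderiv_apply e 2).toLp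
  have hb : MemLp (fun x => ψ x • e) 2 (vol Ω) :=
    (ContinuousLinearMap.toSpanSingleton ℝ e).comp_memLp' (hψ.memLp 2)
  let b : Lp (Space N) 2 (vol Ω) := hb.toLp
  have ha : ∀ f : Lp ℝ 2 (vol Ω), inner ℝ a f = ∫ x in Ω, f x * fderiv ℝ ψ x e := fun f => by
    rw [L2.inner_def]
    refine integral_congr_ae ?_
    filter_upwards [(hψ.memLp_fderiv_apply e 2).coeFn_toLp] with x hx
    rw [hx]; simp
  have hbf : ∀ f : Lp (Space N) 2 (vol Ω), inner ℝ b f = ∫ x in Ω, inner ℝ e (f x) * ψ x :=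
    fun f => by
    rw [L2.inner_def]
    refine integral_congr_ae ?_
    filter_upwards [hb.coeFn_toLp] with x hx
    rw [hx, inner_smul_left, mul_comm]; simp
  have key := H01_induction (P := fun p : L2Pair Ω => inner ℝ a p.fst = - inner ℝ b p.snd)
    ?_ (fun p φ hφ h1 h2 => ?_) u
  · rw [ha, hbf] at key
    exact key
  · have c1 := (WithLp.fstL 2 ℝ (Lp ℝ 2 (vol Ω)) (Lp (Space N) 2 (vol Ω))).continuous
    have c2 := (WithLp.sndL 2 ℝ (Lp ℝ 2 (vol Ω)) (Lp (Space N) 2 (vol Ω))).continuous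
    exact isClosed_eq (continuous_const.inner c1) (continuous_const.inner c2).neg
  · have e1 : ∫ x in Ω, p.fst x * fderiv ℝ ψ x e = ∫ x, φ x * fderiv ℝ ψ x e := by
      rw [← setIntegral_eq_integral_of_forall_compl_eq_zero (s := Ω)
        (f := fun x => φ x * fderiv ℝ ψ x e) (fun x hx => by simp [hφ.eq_zero hx])]
      exact integral_congr_ae (h1.mono fun x hx => by simp only [hx])
    have e2 : ∫ x in Ω, inner ℝ e (p.snd x) * ψ x = ∫ x, fderiv ℝ φ x e * ψ x := by
      rw [← setIntegral_eq_integral_of_forall_compl_eq_zero (s := Ω)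
        (f := fun x => fderiv ℝ φ x e * ψ x) (fun x hx => by simp [hψ.eq_zero hx])]
      refine integral_congr_ae (h2.mono fun x hx => ?_)
      simp only [hx, gradient]
      rw [real_inner_comm, InnerProductSpace.toDual_symm_apply]
    rw [ha, hbf, e1, e2]
    have cφ := hφ.smooth.continuous
    have cψ := hψ.smooth.continuous
    have cφ' : Continuous fun x => fderiv ℝ φ x e :=
      (hφ.contDiff_one.continuous_fderiv (by simp)).clm_apply continuous_const
    have cψ' : Continuous fun x => fderiv ℝ ψ x e :=
      (hψ.contDiff_one.continuous_fderiv (by simp)).clm_apply continuous_const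
    exact integral_mul_fderiv_eq_neg_fderiv_mul_of_integrable
      ((cφ'.mul cψ).integrable_of_hasCompactSupport hψ.compact.mul_left)
      ((cφ.mul cψ').integrable_of_hasCompactSupport hφ.compact.mul_right)
      ((cφ.mul cψ).integrable_of_hasCompactSupport hφ.compact.mul_right)
      (fun x _ => hφ.contDiff_one.differentiable (by simp) x)
      (fun x _ => hψ.contDiff_one.differentiable (by simp) x)

/-- If the function vanishes, its weak gradient is orthogonal to all test functions, hence zero by
the fundamental lemma of the calculus of variations. -/
theorem toL2_injective (hΩ : IsOpen Ω) (hΩb : Bornology.IsBounded Ω) :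
    Function.Injective (toL2 Ω) := by
  have : IsFiniteMeasure (vol Ω) := ⟨by simpa using hΩb.measure_lt_top⟩
  rw [injective_iff_map_eq_zero]
  intro u hu
  have hfn : fn u =ᵐ[vol Ω] 0 := by
    rw [← coe_toL2, hu]; exact Lp.coeFn_zero _ _ _
  have hgi : Integrable (grad u) (vol Ω) := (Lp.memLp (gradL2 Ω u)).integrable (by norm_num)
  have hg : gradL2 Ω u = 0 := by
    rw [Lp.eq_zero_iff_ae_eq_zero]
    refine (ae_restrict_iff' hΩ.measurableSet).2 ?_
    refine hΩ.ae_eq_zero_of_integral_contDiff_smul_eq_zero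
      (IntegrableOn.locallyIntegrableOn hgi) fun ψ h1 h2 h3 => ?_
    have hψ : IsTestFunction Ω ψ := ⟨h1, h2, h3⟩
    rw [coe_gradL2, ← setIntegral_eq_integral_of_forall_compl_eq_zero (s := Ω)
      (fun x hx => by simp [hψ.eq_zero hx])]
    have hi : Integrable (fun x => ψ x • grad u x) (vol Ω) :=
      memLp_one_iff_integrable.1 ((Lp.memLp (gradL2 Ω u)).smul (hψ.memLp 2))
    refine ext_inner_left ℝ fun e => ?_
    rw [← integral_inner hi, inner_zero_right]
    have h4 := integral_fn_mul_fderiv u hψ e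
    rw [integral_congr_ae (g := fun _ => 0) (hfn.mono fun x hx => by simp [hx]), integral_zero] at h4
    simp_rw [inner_smul_right, mul_comm (ψ _)]
    linarith
  have h5 := norm_sq_H01 u
  rw [hu, hg] at h5
  simpa using h5

/-- The **Sobolev inequality** `‖u‖_{L⁴} ≤ C ‖∇u‖_{L²}` in dimension at most `4`. -/
theorem exists_eLpNorm_four_le (hN : 1 ≤ N) (hN' : N ≤ 4) (hΩ : IsOpen Ω)
    (hΩb : Bornology.IsBounded Ω) :
    ∃ C : ℝ≥0, ∀ u : H01 Ω, eLpNorm (fn u) 4 (vol Ω) ≤ C * ‖gradL2 Ω u‖ₑ := by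
  obtain ⟨C, hC⟩ := exists_eLpNorm_four_test_le hN hN' hΩ hΩb
  refine ⟨C, fun u => ?_⟩
  refine H01_induction (P := fun p : L2Pair Ω => eLpNorm p.fst 4 (vol Ω) ≤ C * ‖p.snd‖ₑ)
    ?_ (fun p φ hφ h1 h2 => ?_) u
  -- The `L⁴` norm is only lower semicontinuous under `L²` convergence: pass to an a.e. convergent
  -- subsequence and use Fatou.
  · refine IsSeqClosed.isClosed fun p q hp hpq => ?_
    have c1 := (WithLp.fstL 2 ℝ (Lp ℝ 2 (vol Ω)) (Lp (Space N) 2 (vol Ω))).continuous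
    have c2 := (WithLp.sndL 2 ℝ (Lp ℝ 2 (vol Ω)) (Lp (Space N) 2 (vol Ω))).continuous
    have t1 := (c1.tendsto q).comp hpq
    have t2 := (c2.tendsto q).comp hpq
    obtain ⟨ns, hns, hae⟩ := (tendstoInMeasure_of_tendsto_Lp t1).exists_seq_tendsto_ae
    have t3 : Tendsto (fun i => C * ‖(p (ns i)).snd‖ₑ) atTop (𝓝 (C * ‖q.snd‖ₑ)) :=
      ENNReal.Tendsto.const_mul ((continuous_enorm.tendsto _).comp (t2.comp hns.tendsto_atTop))
        (Or.inr ENNReal.coe_ne_top)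
    refine (Lp.eLpNorm_lim_le_liminf_eLpNorm (fun i => Lp.aestronglyMeasurable (p (ns i)).fst)
      _ hae).trans ?_
    rw [← t3.liminf_eq]
    exact liminf_le_liminf (.of_forall fun i => hp (ns i))
  · rw [eLpNorm_congr_ae h1, Lp.enorm_def, eLpNorm_congr_ae h2]
    exact hC φ hφ

end

/-! ### The first eigenvalue, Schrödinger forms and products. -/

section

variable {N : ℕ} {Ω : Set (Space N)}

/-- The Dirichlet form `∫ ∇u · ∇v`. -/
def dirichletForm (Ω : Set (Space N)) : H01 Ω →L[ℝ] H01 Ω →L[ℝ] ℝ :=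
  (innerSL ℝ).bilinearComp (gradL2 Ω) (gradL2 Ω)

theorem dirichletForm_apply (u v : H01 Ω) :
    dirichletForm Ω u v = inner ℝ (gradL2 Ω u) (gradL2 Ω v) := rfl

theorem inner_gradL2 (u v : H01 Ω) :
    inner ℝ (gradL2 Ω u) (gradL2 Ω v) = ∫ x in Ω, inner ℝ (grad u x) (grad v x) := rfl

theorem inner_toL2 (u v : H01 Ω) :
    inner ℝ (toL2 Ω u) (toL2 Ω v) = ∫ x in Ω, fn u x * fn v x := by
  rw [L2.inner_def]
  refine integral_congr_ae (.of_forall fun x => ?_)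
  simp [coe_toL2, mul_comm]

theorem exists_dirichletForm_coercive (hN : 1 ≤ N) (hΩ : IsOpen Ω) (hΩb : Bornology.IsBounded Ω) :
    ∃ c : ℝ, 0 < c ∧ ∀ u : H01 Ω, c * ‖u‖ ^ 2 ≤ dirichletForm Ω u u := by
  obtain ⟨C, hC, hP⟩ := exists_poincare hN hΩ hΩb
  refine ⟨(C + 1)⁻¹, by positivity, fun u => ?_⟩
  rw [dirichletForm_apply, real_inner_self_eq_norm_sq, inv_mul_le_iff₀ (by positivity),
    norm_sq_H01]
  linarith [hP u]

/-- Test the equation with the eigenfunction itself. This bounds the eigenvalues below, so that the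
`sInf` defining `λ₁` is a lower bound for them. -/
theorem IsDirichletEigenvalue.nonneg (hΩ : IsOpen Ω) (hΩb : Bornology.IsBounded Ω) {ν : ℝ}
    (h : IsDirichletEigenvalue Ω ν) : 0 ≤ ν := by
  obtain ⟨φ, hφ, h⟩ := h
  have h1 := h φ
  rw [← inner_gradL2, ← inner_toL2, real_inner_self_eq_norm_sq, real_inner_self_eq_norm_sq] at h1
  have h2 : 0 < ‖toL2 Ω φ‖ ^ 2 := by
    have : toL2 Ω φ ≠ 0 := fun h0 =>
      hφ ((injective_iff_map_eq_zero _).1 (toL2_injective hΩ hΩb) φ h0)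
    positivity
  exact nonneg_of_mul_nonneg_left (h1 ▸ sq_nonneg _) h2

/-- The Rayleigh characterization of `λ₁` as a lower bound. -/
theorem firstEigenvalue_mul_le (hN : 1 ≤ N) (hΩ : IsOpen Ω) (hΩb : Bornology.IsBounded Ω)
    (u : H01 Ω) : firstEigenvalue Ω * ‖toL2 Ω u‖ ^ 2 ≤ ‖gradL2 Ω u‖ ^ 2 := by
  -- Beyond this trivial case `u` witnesses `toL2 Ω ≠ 0`, so an eigenvalue exists and the default
  -- value of `sInf ∅` plays no role.
  by_cases hu : toL2 Ω u = 0
  · simp [hu]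
  obtain ⟨c, hc, hcA⟩ := exists_dirichletForm_coercive hN hΩ hΩb
  obtain ⟨μ, ⟨φ, hφ0, hφ⟩, hμ⟩ := exists_rayleigh_minimizer (dirichletForm Ω)
    (fun v w => by rw [dirichletForm_apply, dirichletForm_apply, real_inner_comm]) hc hcA
    (toL2 Ω) (isCompactOperator_toL2 hΩ hΩb) hu
  have h1 : firstEigenvalue Ω ≤ μ := by
    refine csInf_le ⟨0, fun ν hν => IsDirichletEigenvalue.nonneg hΩ hΩb hν⟩ ⟨φ, hφ0, fun ψ => ?_⟩
    rw [← inner_gradL2, ← inner_toL2]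
    exact hφ ψ
  refine (mul_le_mul_of_nonneg_right h1 (sq_nonneg _)).trans ?_
  have h2 := hμ u
  rwa [dirichletForm_apply, real_inner_self_eq_norm_sq] at h2

/-- Multiplication by a bounded function on `L²(Ω)`. -/
def mulL2 (Ω : Set (Space N)) {α : Space N → ℝ} (hα : MemLp α ⊤ (vol Ω)) :
    Lp ℝ 2 (vol Ω) →L[ℝ] Lp ℝ 2 (vol Ω) :=
  (ContinuousLinearMap.mul ℝ ℝ).holderL (vol Ω) ⊤ 2 2 hα.toLp

theorem coeFn_mulL2 {α : Space N → ℝ} (hα : MemLp α ⊤ (vol Ω)) (f : Lp ℝ 2 (vol Ω)) :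
    mulL2 Ω hα f =ᵐ[vol Ω] fun x => α x * f x := by
  filter_upwards [(ContinuousLinearMap.mul ℝ ℝ).coeFn_holder (r := 2) hα.toLp f,
    hα.coeFn_toLp] with x h1 h2
  rw [h2] at h1
  exact h1

/-- The quadratic form `∫ (e |∇u|² + α u²)`. -/
def schrodingerForm (Ω : Set (Space N)) (e : ℝ) {α : Space N → ℝ} (hα : MemLp α ⊤ (vol Ω)) :
    H01 Ω →L[ℝ] H01 Ω →L[ℝ] ℝ :=
  let F : H01 Ω →L[ℝ] H01 Ω →L[ℝ] ℝ :=
    (innerSL ℝ).bilinearComp (toL2 Ω) ((mulL2 Ω hα).comp (toL2 Ω))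
  e • dirichletForm Ω + F

theorem schrodingerForm_self (e : ℝ) {α : Space N → ℝ} (hα : MemLp α ⊤ (vol Ω)) (u : H01 Ω) :
    schrodingerForm Ω e hα u u =
      e * ‖gradL2 Ω u‖ ^ 2 + inner ℝ (toL2 Ω u) (mulL2 Ω hα (toL2 Ω u)) := by
  rw [← real_inner_self_eq_norm_sq]
  rfl

theorem integrable_norm_grad_sq (u : H01 Ω) : Integrable (fun x => ‖grad u x‖ ^ 2) (vol Ω) :=
  (Lp.memLp (gradL2 Ω u)).integrable_norm_pow (by simp)

theorem integral_norm_grad_sq (u : H01 Ω) : ∫ x in Ω, ‖grad u x‖ ^ 2 = ‖gradL2 Ω u‖ ^ 2 := by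
  rw [← real_inner_self_eq_norm_sq, inner_gradL2]
  simp_rw [real_inner_self_eq_norm_sq]

theorem ae_inner_mulL2 {α : Space N → ℝ} (hα : MemLp α ⊤ (vol Ω)) (u : H01 Ω) :
    (fun x => inner ℝ (toL2 Ω u x) (mulL2 Ω hα (toL2 Ω u) x)) =ᵐ[vol Ω]
      fun x => α x * fn u x ^ 2 := by
  filter_upwards [coeFn_mulL2 hα (toL2 Ω u)] with x hx
  rw [hx, coe_toL2]
  simp only [RCLike.inner_apply, conj_trivial]
  ring

theorem integrable_mul_fn_sq {α : Space N → ℝ} (hα : MemLp α ⊤ (vol Ω)) (u : H01 Ω) :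
    Integrable (fun x => α x * fn u x ^ 2) (vol Ω) :=
  (L2.integrable_inner _ _).congr (ae_inner_mulL2 hα u)

theorem inner_mulL2 {α : Space N → ℝ} (hα : MemLp α ⊤ (vol Ω)) (u : H01 Ω) :
    inner ℝ (toL2 Ω u) (mulL2 Ω hα (toL2 Ω u)) = ∫ x in Ω, α x * fn u x ^ 2 :=
  integral_congr_ae (ae_inner_mulL2 hα u)

theorem integrable_schrodinger (e : ℝ) {α : Space N → ℝ} (hα : MemLp α ⊤ (vol Ω)) (u : H01 Ω) :
    Integrable (fun x => e * ‖grad u x‖ ^ 2 + α x * fn u x ^ 2) (vol Ω) :=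
  ((integrable_norm_grad_sq u).const_mul e).add (integrable_mul_fn_sq hα u)

theorem schrodingerForm_eq_integral (e : ℝ) {α : Space N → ℝ} (hα : MemLp α ⊤ (vol Ω))
    (u : H01 Ω) :
    schrodingerForm Ω e hα u u = ∫ x in Ω, (e * ‖grad u x‖ ^ 2 + α x * fn u x ^ 2) := by
  rw [schrodingerForm_self, integral_add ((integrable_norm_grad_sq u).const_mul e)
    (integrable_mul_fn_sq hα u), integral_const_mul, integral_norm_grad_sq, inner_mulL2]

/-- By the Rayleigh bound the form is at least `∫ (e λ₁ + α) u²`, whose weight is positive a.e. -/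
theorem schrodingerForm_pos (hN : 1 ≤ N) (hΩ : IsOpen Ω) (hΩb : Bornology.IsBounded Ω) {e : ℝ}
    (he : 0 < e) {α : Space N → ℝ} (hα : MemLp α ⊤ (vol Ω))
    (hα' : ∀ᵐ x ∂(vol Ω), -(e * firstEigenvalue Ω) < α x) {u : H01 Ω} (hu : u ≠ 0) :
    0 < schrodingerForm Ω e hα u u := by
  have : IsFiniteMeasure (vol Ω) := ⟨by simpa using hΩb.measure_lt_top⟩
  set c := e * firstEigenvalue Ω with hc
  have h1 := mul_le_mul_of_nonneg_left (firstEigenvalue_mul_le hN hΩ hΩb u) he.le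
  have hi1 := integrable_mul_fn_sq (memLp_const c) u
  have hi2 := integrable_mul_fn_sq hα u
  have hn : ∫ x in Ω, c * fn u x ^ 2 = c * ‖toL2 Ω u‖ ^ 2 := by
    rw [integral_const_mul, ← real_inner_self_eq_norm_sq, inner_toL2]
    simp_rw [pow_two]
  have hnn : 0 ≤ᵐ[vol Ω] fun x => c * fn u x ^ 2 + α x * fn u x ^ 2 := by
    filter_upwards [hα'] with x hx
    rw [← add_mul]
    exact mul_nonneg (by linarith) (sq_nonneg _)
  have hpos : 0 < ∫ x in Ω, (c * fn u x ^ 2 + α x * fn u x ^ 2) := by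
    refine (integral_nonneg_of_ae hnn).lt_of_ne fun h0 => hu ?_
    have h2 := (integral_eq_zero_iff_of_nonneg_ae hnn (hi1.add hi2)).1 h0.symm
    refine (injective_iff_map_eq_zero _).1 (toL2_injective hΩ hΩb) u ?_
    rw [Lp.eq_zero_iff_ae_eq_zero]
    filter_upwards [h2, hα'] with x hx hx'
    simp only [Pi.zero_apply] at hx
    rw [← add_mul] at hx
    rcases mul_eq_zero.1 hx with h3 | h3
    · linarith
    · exact pow_eq_zero_iff (two_ne_zero) |>.1 h3
  rw [integral_add hi1 hi2, hn] at hpos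
  rw [schrodingerForm_self, inner_mulL2]
  rw [← mul_assoc, ← hc] at h1
  linarith

theorem exists_schrodingerForm_coercive (hN : 1 ≤ N) (hΩ : IsOpen Ω)
    (hΩb : Bornology.IsBounded Ω) {e : ℝ} (he : 0 < e) {α : Space N → ℝ}
    (hα : MemLp α ⊤ (vol Ω)) (hα' : ∀ᵐ x ∂(vol Ω), -(e * firstEigenvalue Ω) < α x) :
    ∃ c : ℝ, 0 < c ∧ ∀ u : H01 Ω, c * ‖u‖ ^ 2 ≤ schrodingerForm Ω e hα u u := by
  refine exists_coercive_of_compact (schrodingerForm Ω e hα) (toL2 Ω)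
    (isCompactOperator_toL2 hΩ hΩb) (fun u hu => schrodingerForm_pos hN hΩ hΩb he hα hα' hu) he
    -- The summand `e` completes `e ‖∇u‖²` to the full norm; the other absorbs the potential.
    (C := e + ‖mulL2 Ω hα‖) fun u => ?_
  rw [schrodingerForm_self, norm_sq_H01]
  have h1 := neg_le_of_abs_le (abs_real_inner_le_norm (toL2 Ω u) (mulL2 Ω hα (toL2 Ω u)))
  have h2 := mul_le_mul_of_nonneg_left ((mulL2 Ω hα).le_opNorm (toL2 Ω u)) (norm_nonneg (toL2 Ω u))
  nlinarith

/-- The product of two functions in `H_0^1(Ω)`, as a bounded bilinear map into `L²(Ω)`, in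
dimension at most `4`. -/
theorem exists_product (hN : 1 ≤ N) (hN' : N ≤ 4) (hΩ : IsOpen Ω) (hΩb : Bornology.IsBounded Ω) :
    ∃ P : H01 Ω →L[ℝ] H01 Ω →L[ℝ] Lp ℝ 2 (vol Ω),
      (∀ u v, P u v =ᵐ[vol Ω] fun x => fn u x * fn v x) ∧
      ∃ C : ℝ, 0 ≤ C ∧ ∀ u, ‖P u u‖ ≤ C * ‖gradL2 Ω u‖ ^ 2 := by
  obtain ⟨C, hC⟩ := exists_eLpNorm_four_le hN hN' hΩ hΩb
  have : ENNReal.HolderTriple 4 4 2 := ⟨by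
    rw [← two_mul, show (4 : ℝ≥0∞) = 2 * 2 by norm_num, ENNReal.mul_inv (by simp) (by simp),
      ← mul_assoc, ENNReal.mul_inv_cancel (by simp) (by simp), one_mul]⟩
  have : Fact ((1 : ℝ≥0∞) ≤ 4) := ⟨by norm_num⟩
  have hmem : ∀ u : H01 Ω, MemLp (fn u) 4 (vol Ω) := fun u =>
    ⟨Lp.aestronglyMeasurable (toL2 Ω u), (hC u).trans_lt (by finiteness)⟩
  have hnorm : ∀ u : H01 Ω, ‖(hmem u).toLp‖ ≤ C * ‖gradL2 Ω u‖ := fun u => by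
    rw [Lp.norm_toLp]
    refine ENNReal.toReal_le_of_le_ofReal (by positivity) ((hC u).trans_eq ?_)
    rw [ENNReal.ofReal_mul (NNReal.coe_nonneg C), ofReal_norm, ENNReal.ofReal_coe_nnreal]
  let T₀ : H01 Ω →ₗ[ℝ] Lp ℝ 4 (vol Ω) :=
    { toFun := fun u => (hmem u).toLp
      map_add' := fun u v => by
        rw [← MemLp.toLp_add]
        exact MemLp.toLp_congr _ _ (Lp.coeFn_add (toL2 Ω u) (toL2 Ω v))
      map_smul' := fun c u => by
        rw [RingHom.id_apply, ← MemLp.toLp_const_smul]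
        exact MemLp.toLp_congr _ _ (Lp.coeFn_smul c (toL2 Ω u)) }
  let T : H01 Ω →L[ℝ] Lp ℝ 4 (vol Ω) := T₀.mkContinuous (C * ‖gradL2 Ω‖) fun u =>
    (hnorm u).trans (by
      rw [mul_assoc]
      exact mul_le_mul_of_nonneg_left ((gradL2 Ω).le_opNorm u) C.2)
  have hT : ∀ u, T u = (hmem u).toLp := fun u => rfl
  let B := ContinuousLinearMap.mul ℝ ℝ
  refine ⟨(B.holderL (vol Ω) 4 4 2).bilinearComp T T, fun u v => ?_, C ^ 2, by positivity,
    fun u => ?_⟩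
  · filter_upwards [B.coeFn_holder (r := 2) (T u) (T v), (hmem u).coeFn_toLp,
      (hmem v).coeFn_toLp] with x h1 h2 h3
    rw [hT, hT, h2, h3] at h1
    exact h1
  · have h1 := B.norm_holder_apply_apply_le (r := 2) (T u) (T u)
    have h2 : ‖B‖ ≤ 1 := ContinuousLinearMap.opNorm_mul_le ℝ ℝ
    have h3 : ‖T u‖ ≤ C * ‖gradL2 Ω u‖ := hnorm u
    calc _ ≤ ‖B‖ * ‖T u‖ * ‖T u‖ := h1
      _ ≤ 1 * (C * ‖gradL2 Ω u‖) * (C * ‖gradL2 Ω u‖) := by gcongr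
      _ = _ := by ring

end

/-! ### Positivity of the quartic form and smoothness of the energy. -/

section

/-- Applied pointwise with `yᵢ = uᵢ(x)²`. For positive entries, `y ≥ 0` makes all terms nonnegative
and one diagonal term positive. -/
theorem quadratic_pos {m : ℕ} {g : Matrix (Fin m) (Fin m) ℝ}
    (hg : (∀ i j, 0 < g i j) ∨ g.PosDef) {y : Fin m → ℝ} (hy : ∀ i, 0 ≤ y i) (hy0 : y ≠ 0) :
    0 < ∑ i, ∑ j, g i j * y i * y j := by
  rcases hg with hg | hg
  · obtain ⟨k, hk⟩ := Function.ne_iff.1 hy0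
    have hk' : 0 < y k := (hy k).lt_of_ne' hk
    have hnn : ∀ i j, 0 ≤ g i j * y i * y j := fun i j =>
      mul_nonneg (mul_nonneg (hg i j).le (hy i)) (hy j)
    calc 0 < g k k * y k * y k := mul_pos (mul_pos (hg k k) hk') hk'
      _ ≤ ∑ j, g k j * y k * y j :=
        Finset.single_le_sum (f := fun j => g k j * y k * y j) (fun j _ => hnn k j)
          (Finset.mem_univ k)
      _ ≤ _ := Finset.single_le_sum (f := fun i => ∑ j, g i j * y i * y j)
          (fun i _ => Finset.sum_nonneg fun j _ => hnn i j) (Finset.mem_univ k)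
  · have h := hg.dotProduct_mulVec_pos hy0
    simp only [dotProduct, Matrix.mulVec, star_trivial, Finset.mul_sum] at h
    refine h.trans_eq (Finset.sum_congr rfl fun i _ => Finset.sum_congr rfl fun j _ => ?_)
    ring

theorem contDiff_quartic_energy {m : ℕ} {V W : Type*} [NormedAddCommGroup V] [NormedSpace ℝ V]
    [NormedAddCommGroup W] [InnerProductSpace ℝ W] (B : Fin m → V →L[ℝ] V →L[ℝ] ℝ)
    (P : V →L[ℝ] V →L[ℝ] W) (g : Matrix (Fin m) (Fin m) ℝ) :
    ContDiff ℝ 2 fun u : PiLp 2 (fun _ : Fin m => V) => 1 / 2 * ∑ i, B i (u i) (u i) -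
      1 / 4 * ∑ i, ∑ j, g i j * inner ℝ (P (u i) (u i)) (P (u j) (u j)) := by
  have hp : ∀ i, ContDiff ℝ 2 fun u : PiLp 2 (fun _ : Fin m => V) => u i := fun i =>
    (PiLp.proj 2 (fun _ : Fin m => V) i : PiLp 2 (fun _ : Fin m => V) →L[ℝ] V).contDiff
  have hPu : ∀ i, ContDiff ℝ 2 fun u : PiLp 2 (fun _ : Fin m => V) => P (u i) (u i) := fun i =>
    (P.contDiff.comp (hp i)).clm_apply (hp i)
  refine (contDiff_const.mul (ContDiff.sum fun i _ => ?_)).sub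
    (contDiff_const.mul (ContDiff.sum fun i _ => ContDiff.sum fun j _ =>
      contDiff_const.mul ((hPu i).inner ℝ (hPu j))))
  exact ((B i).contDiff.comp (hp i)).clm_apply (hp i)

/-! ### Functions of the form `s² k / 2 - s⁴ l / 4` along a ray. -/

section Rays

theorem hasDerivAt_ray {X : Type*} [SMul ℝ X] {f : X → ℝ} {v : X} {k l : ℝ}
    (h : ∀ s : ℝ, f (s • v) = 1 / 2 * (s ^ 2 * k) - 1 / 4 * (s ^ 4 * l)) (s : ℝ) :
    HasDerivAt (fun r : ℝ => f (r • v)) (s * k - s ^ 3 * l) s := by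
  simp_rw [h]
  have h1 := (((hasDerivAt_pow 2 s).mul_const k).const_mul (1 / 2)).sub
    (((hasDerivAt_pow 4 s).mul_const l).const_mul (1 / 4))
  refine h1.congr_deriv ?_
  norm_num
  ring

theorem hasDerivAt_ray_zero_iff {X : Type*} [SMul ℝ X] {f : X → ℝ} {v : X} {k l : ℝ}
    (hk : 0 < k) (hl : 0 < l)
    (h : ∀ s : ℝ, f (s • v) = 1 / 2 * (s ^ 2 * k) - 1 / 4 * (s ^ 4 * l)) {t : ℝ} (ht : 0 < t) :
    HasDerivAt (fun r : ℝ => f (r • v)) 0 t ↔ t = Real.sqrt (k / l) := by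
  constructor
  · intro h0
    have h1 : t * k - t ^ 3 * l = 0 := (hasDerivAt_ray h t).unique h0
    have h2 : t * (k - t ^ 2 * l) = 0 := by linear_combination h1
    have h3 : k - t ^ 2 * l = 0 := (mul_eq_zero.1 h2).resolve_left ht.ne'
    have h4 : k / l = t ^ 2 := by rw [div_eq_iff hl.ne']; linarith
    rw [h4, Real.sqrt_sq ht.le]
  · intro h0
    have h1 : t ^ 2 * l = k := by
      rw [h0, Real.sq_sqrt (div_pos hk hl).le, div_mul_cancel₀ _ hl.ne']
    exact (hasDerivAt_ray h t).congr_deriv (by linear_combination -t * h1)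

variable {X : Type*} [NormedAddCommGroup X] [NormedSpace ℝ X] {f : X → ℝ} {k l : ℝ} {v : X}

theorem fderiv_ray (hf : ContDiff ℝ 2 f)
    (h : ∀ s : ℝ, f (s • v) = 1 / 2 * (s ^ 2 * k) - 1 / 4 * (s ^ 4 * l)) (s : ℝ) :
    fderiv ℝ f (s • v) v = s * k - s ^ 3 * l := by
  have h1 : HasDerivAt (fun r : ℝ => r • v) v s := by
    simpa using (hasDerivAt_id s).smul_const v
  exact ((hf.differentiable (by simp) _).hasFDerivAt.comp_hasDerivAt s h1).unique
    (hasDerivAt_ray h s)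

theorem fderiv_fderiv_ray (hf : ContDiff ℝ 2 f)
    (h : ∀ s : ℝ, f (s • v) = 1 / 2 * (s ^ 2 * k) - 1 / 4 * (s ^ 4 * l)) :
    fderiv ℝ (fderiv ℝ f) v v v = k - 3 * l := by
  have h1 : HasDerivAt (fun r : ℝ => r • v) v 1 := by
    simpa using (hasDerivAt_id (1 : ℝ)).smul_const v
  have hd : Differentiable ℝ (fderiv ℝ f) :=
    (hf.fderiv_right (m := 1) (by norm_num)).differentiable (by simp)
  have h2 : HasDerivAt (fun r : ℝ => fderiv ℝ f (r • v) v)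
      (fderiv ℝ (fderiv ℝ f) ((1 : ℝ) • v) v v) 1 := by
    have h3 := (hd ((1 : ℝ) • v)).hasFDerivAt.comp_hasDerivAt (1 : ℝ) h1
    simpa using h3.clm_apply (hasDerivAt_const (1 : ℝ) v)
  simp_rw [fderiv_ray hf h] at h2
  rw [one_smul] at h2
  have h4 := ((hasDerivAt_id (1 : ℝ)).mul_const k).sub ((hasDerivAt_pow 3 (1 : ℝ)).mul_const l)
  refine (h2.unique h4).trans ?_
  norm_num

theorem eq_of_fderiv_self_eq_zero (hf : ContDiff ℝ 2 f)
    (h : ∀ s : ℝ, f (s • v) = 1 / 2 * (s ^ 2 * k) - 1 / 4 * (s ^ 4 * l))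
    (hv : fderiv ℝ f v v = 0) : k = l := by
  have h1 := fderiv_ray hf h 1
  rw [one_smul, hv] at h1
  linarith

theorem fderiv_ray_critical (hf : ContDiff ℝ 2 f) (hk : 0 < k) (hl : 0 < l)
    (h : ∀ s : ℝ, f (s • v) = 1 / 2 * (s ^ 2 * k) - 1 / 4 * (s ^ 4 * l)) (hv : v ≠ 0) :
    Real.sqrt (k / l) • v ≠ 0 ∧
      fderiv ℝ f (Real.sqrt (k / l) • v) (Real.sqrt (k / l) • v) = 0 := by
  have hs : 0 < Real.sqrt (k / l) := Real.sqrt_pos.2 (div_pos hk hl)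
  refine ⟨smul_ne_zero hs.ne' hv, ?_⟩
  have h1 : Real.sqrt (k / l) ^ 2 * l = k := by
    rw [Real.sq_sqrt (div_pos hk hl).le, div_mul_cancel₀ _ hl.ne']
  rw [map_smul, fderiv_ray hf h, smul_eq_mul]
  linear_combination -Real.sqrt (k / l) ^ 2 * h1

end Rays

/-! ### The functionals `K`, `I` and `E` on `H Ω m`. -/

variable {N m : ℕ} {Ω : Set (Space N)} {ε : Fin m → ℝ} {a : Fin m → Space N → ℝ}
  {g : Matrix (Fin m) (Fin m) ℝ}

theorem sum_integral_eq_K (ha : ∀ i, MemLp (a i) ⊤ (vol Ω)) (u : H Ω m) :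
    ∑ i, ∫ x in Ω, (ε i * ‖grad (u i) x‖ ^ 2 + a i x * fn (u i) x ^ 2) = K ε a u :=
  (integral_finsetSum _ fun i _ => integrable_schrodinger (ε i) (ha i) (u i)).symm

theorem K_eq_sum (ha : ∀ i, MemLp (a i) ⊤ (vol Ω)) (u : H Ω m) :
    K ε a u = ∑ i, schrodingerForm Ω (ε i) (ha i) (u i) (u i) := by
  rw [← sum_integral_eq_K ha]
  exact Finset.sum_congr rfl fun i _ => (schrodingerForm_eq_integral _ _ _).symm

theorem hNorm_sq (hε : ∀ i, 0 < ε i) (u : H Ω m) :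
    hNorm ε u ^ 2 = ∑ i, ε i * ‖gradL2 Ω (u i)‖ ^ 2 := by
  have h : ∫ x in Ω, ∑ i, ε i * ‖grad (u i) x‖ ^ 2 = ∑ i, ε i * ‖gradL2 Ω (u i)‖ ^ 2 := by
    rw [integral_finsetSum _ fun i _ => (integrable_norm_grad_sq (u i)).const_mul (ε i)]
    simp_rw [integral_const_mul, integral_norm_grad_sq]
  rw [hNorm, h, Real.sq_sqrt]
  exact Finset.sum_nonneg fun i _ => mul_nonneg (hε i).le (sq_nonneg _)

theorem norm_gradL2_sq_le (hε : ∀ i, 0 < ε i) (u : H Ω m) (i : Fin m) :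
    ‖gradL2 Ω (u i)‖ ^ 2 ≤ (ε i)⁻¹ * hNorm ε u ^ 2 := by
  rw [le_inv_mul_iff₀ (hε i), hNorm_sq hε]
  exact Finset.single_le_sum (f := fun i => ε i * ‖gradL2 Ω (u i)‖ ^ 2)
    (fun i _ => mul_nonneg (hε i).le (sq_nonneg _)) (Finset.mem_univ i)

theorem exists_K_coercive (hN : 1 ≤ N) (hΩ : IsOpen Ω) (hΩb : Bornology.IsBounded Ω)
    (hε : ∀ i, 0 < ε i) (ha : ∀ i, MemLp (a i) ⊤ (vol Ω))
    (ha' : ∀ i, ∀ᵐ x ∂(vol Ω), -(ε i * firstEigenvalue Ω) < a i x) :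
    ∃ c : ℝ, 0 < c ∧ ∀ u : H Ω m, c * hNorm ε u ^ 2 ≤ K ε a u := by
  choose c hc hcK using fun i =>
    exists_schrodingerForm_coercive hN hΩ hΩb (hε i) (ha i) (ha' i)
  have hS : ∀ i ∈ Finset.univ, 0 ≤ ε i / c i := fun i _ => (div_pos (hε i) (hc i)).le
  -- The sum dominates each ratio `ε i / c i`; the added 1 keeps it positive when `m = 0`.
  have hS0 : 0 < 1 + ∑ i, ε i / c i := add_pos_of_pos_of_nonneg one_pos (Finset.sum_nonneg hS)
  refine ⟨(1 + ∑ i, ε i / c i)⁻¹, inv_pos.2 hS0, fun u => ?_⟩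
  rw [inv_mul_le_iff₀ hS0, hNorm_sq hε, K_eq_sum ha, Finset.mul_sum]
  refine Finset.sum_le_sum fun i hi => ?_
  have h1 : ‖gradL2 Ω (u i)‖ ^ 2 ≤ ‖u i‖ ^ 2 := by
    rw [norm_sq_H01]; linarith [sq_nonneg ‖toL2 Ω (u i)‖]
  have h2 : ε i / c i ≤ 1 + ∑ i, ε i / c i := by
    linarith [Finset.single_le_sum hS hi]
  have h3 : 0 ≤ schrodingerForm Ω (ε i) (ha i) (u i) (u i) :=
    (mul_nonneg (hc i).le (sq_nonneg _)).trans (hcK i (u i))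
  calc ε i * ‖gradL2 Ω (u i)‖ ^ 2 ≤ ε i * ‖u i‖ ^ 2 :=
        mul_le_mul_of_nonneg_left h1 (hε i).le
    _ = ε i / c i * (c i * ‖u i‖ ^ 2) := by have := (hc i).ne'; field_simp
    _ ≤ ε i / c i * schrodingerForm Ω (ε i) (ha i) (u i) (u i) :=
        mul_le_mul_of_nonneg_left (hcK i (u i)) (hS i hi)
    _ ≤ _ := mul_le_mul_of_nonneg_right h2 h3

theorem K_pos (hN : 1 ≤ N) (hΩ : IsOpen Ω) (hΩb : Bornology.IsBounded Ω)
    (hε : ∀ i, 0 < ε i) (ha : ∀ i, MemLp (a i) ⊤ (vol Ω))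
    (ha' : ∀ i, ∀ᵐ x ∂(vol Ω), -(ε i * firstEigenvalue Ω) < a i x) {u : H Ω m} (hu : u ≠ 0) :
    0 < K ε a u := by
  rw [K_eq_sum ha]
  obtain ⟨k, hk⟩ : ∃ k, u k ≠ 0 := by
    by_contra! h
    exact hu (PiLp.ext h)
  refine Finset.sum_pos' (fun i _ => ?_) ⟨k, Finset.mem_univ k,
    schrodingerForm_pos hN hΩ hΩb (hε k) (ha k) (ha' k) hk⟩
  by_cases h0 : u i = 0
  · simp [h0]
  · exact (schrodingerForm_pos hN hΩ hΩb (hε i) (ha i) (ha' i) h0).le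

section Product

variable {P : H01 Ω →L[ℝ] H01 Ω →L[ℝ] Lp ℝ 2 (vol Ω)}
  (hP : ∀ u v, P u v =ᵐ[vol Ω] fun x => fn u x * fn v x)
include hP

theorem ae_inner_product (c : ℝ) (u v : H01 Ω) :
    (fun x => c * inner ℝ (P u u x) (P v v x)) =ᵐ[vol Ω] fun x => c * fn u x ^ 2 * fn v x ^ 2 := by
  filter_upwards [hP u u, hP v v] with x h1 h2
  rw [h1, h2]
  simp only [RCLike.inner_apply, conj_trivial]
  ring

theorem integrable_quartic (c : ℝ) (u v : H01 Ω) :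
    Integrable (fun x => c * fn u x ^ 2 * fn v x ^ 2) (vol Ω) :=
  ((L2.integrable_inner _ _).const_mul c).congr (ae_inner_product hP c u v)

theorem integral_quartic (c : ℝ) (u v : H01 Ω) :
    ∫ x in Ω, c * fn u x ^ 2 * fn v x ^ 2 = c * inner ℝ (P u u) (P v v) := by
  rw [← integral_congr_ae (ae_inner_product hP c u v), integral_const_mul]
  rfl

theorem sum_integral_eq_I (u : H Ω m) :
    ∑ i, ∑ j, ∫ x in Ω, g i j * fn (u i) x ^ 2 * fn (u j) x ^ 2 = I g u := by
  rw [I, integral_finsetSum _ fun i _ => integrable_finsetSum _ fun j _ =>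
    integrable_quartic hP (g i j) (u i) (u j)]
  refine Finset.sum_congr rfl fun i _ => ?_
  rw [integral_finsetSum _ fun j _ => integrable_quartic hP (g i j) (u i) (u j)]

theorem I_eq_sum (u : H Ω m) :
    I g u = ∑ i, ∑ j, g i j * inner ℝ (P (u i) (u i)) (P (u j) (u j)) := by
  simp_rw [← sum_integral_eq_I hP, integral_quartic hP]

/-- The integrand is nonnegative and vanishes only where all components do; injectivity of `toL2`
turns a.e. vanishing into `u = 0`. -/
theorem I_pos (hΩ : IsOpen Ω) (hΩb : Bornology.IsBounded Ω)
    (hg : (∀ i j, 0 < g i j) ∨ g.PosDef) {u : H Ω m} (hu : u ≠ 0) : 0 < I g u := by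
  have hq : ∀ x, (fun i => fn (u i) x ^ 2) ≠ 0 →
      0 < ∑ i, ∑ j, g i j * fn (u i) x ^ 2 * fn (u j) x ^ 2 := fun x hx =>
    quadratic_pos hg (fun i => sq_nonneg _) hx
  have hnn : ∀ x, 0 ≤ ∑ i, ∑ j, g i j * fn (u i) x ^ 2 * fn (u j) x ^ 2 := fun x => by
    by_cases hx : (fun i => fn (u i) x ^ 2) = 0
    · have hx' : ∀ i, fn (u i) x ^ 2 = 0 := congrFun hx
      simp [hx']
    · exact (hq x hx).le
  refine (integral_nonneg hnn).lt_of_ne fun h0 => hu ?_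
  have h1 := (integral_eq_zero_iff_of_nonneg hnn (integrable_finsetSum _ fun i _ =>
    integrable_finsetSum _ fun j _ => integrable_quartic hP (g i j) (u i) (u j))).1 h0.symm
  refine PiLp.ext fun i => ?_
  refine (injective_iff_map_eq_zero _).1 (toL2_injective hΩ hΩb) (u i) ?_
  rw [Lp.eq_zero_iff_ae_eq_zero]
  filter_upwards [h1] with x hx
  by_contra hne
  refine (hq x fun h => hne ?_).ne' hx
  exact pow_eq_zero_iff two_ne_zero |>.1 (congrFun h i)

theorem exists_I_le (hε : ∀ i, 0 < ε i) {C : ℝ} (hC : 0 ≤ C)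
    (hPC : ∀ u, ‖P u u‖ ≤ C * ‖gradL2 Ω u‖ ^ 2) :
    ∃ D : ℝ, 0 ≤ D ∧ ∀ u : H Ω m, I g u ≤ D * (hNorm ε u ^ 2) ^ 2 := by
  refine ⟨∑ i, ∑ j, |g i j| * ((C * (ε i)⁻¹) * (C * (ε j)⁻¹)), Finset.sum_nonneg fun i _ =>
    Finset.sum_nonneg fun j _ => ?_, fun u => ?_⟩
  · have h1 := (inv_pos.2 (hε i)).le
    have h2 := (inv_pos.2 (hε j)).le
    positivity
  · rw [I_eq_sum hP, Finset.sum_mul]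
    refine Finset.sum_le_sum fun i _ => ?_
    rw [Finset.sum_mul]
    refine Finset.sum_le_sum fun j _ => ?_
    have hw : ∀ i, ‖P (u i) (u i)‖ ≤ C * (ε i)⁻¹ * hNorm ε u ^ 2 := fun i =>
      (hPC (u i)).trans (by
        rw [mul_assoc]; exact mul_le_mul_of_nonneg_left (norm_gradL2_sq_le hε u i) hC)
    calc g i j * inner ℝ (P (u i) (u i)) (P (u j) (u j))
        ≤ |g i j| * |inner ℝ (P (u i) (u i)) (P (u j) (u j))| := by
          rw [← abs_mul]; exact le_abs_self _
      _ ≤ |g i j| * (‖P (u i) (u i)‖ * ‖P (u j) (u j)‖) := by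
          gcongr; exact abs_real_inner_le_norm _ _
      _ ≤ |g i j| * ((C * (ε i)⁻¹ * hNorm ε u ^ 2) * (C * (ε j)⁻¹ * hNorm ε u ^ 2)) := by
          refine mul_le_mul_of_nonneg_left ?_ (abs_nonneg _)
          exact mul_le_mul (hw i) (hw j) (norm_nonneg _) ((norm_nonneg _).trans (hw i))
      _ = _ := by ring

theorem contDiff_E (ha : ∀ i, MemLp (a i) ⊤ (vol Ω)) : ContDiff ℝ 2 (E ε a g : H Ω m → ℝ) := by
  have hE : (E ε a g : H Ω m → ℝ) = fun u =>
      1 / 2 * ∑ i, schrodingerForm Ω (ε i) (ha i) (u i) (u i) -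
        1 / 4 * ∑ i, ∑ j, g i j * inner ℝ (P (u i) (u i)) (P (u j) (u j)) := by
    funext u
    rw [E, K_eq_sum ha, I_eq_sum hP]
  rw [hE]
  exact contDiff_quartic_energy _ _ _

theorem E_smul (ha : ∀ i, MemLp (a i) ⊤ (vol Ω)) (v : H Ω m) (s : ℝ) :
    E ε a g (s • v) = 1 / 2 * (s ^ 2 * K ε a v) - 1 / 4 * (s ^ 4 * I g v) := by
  rw [E, K_eq_sum ha, K_eq_sum ha, I_eq_sum hP, I_eq_sum hP]
  simp only [PiLp.smul_apply, map_smul, smul_apply, inner_smul_left, inner_smul_right,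
    smul_eq_mul, conj_trivial, Finset.mul_sum]
  congr 1
  · exact Finset.sum_congr rfl fun i _ => by ring
  · exact Finset.sum_congr rfl fun i _ => Finset.sum_congr rfl fun j _ => by ring

set_option synthInstance.maxHeartbeats 200000 in
set_option maxHeartbeats 1000000 in
theorem hasDerivAt_E_smul_zero_iff (ha : ∀ i, MemLp (a i) ⊤ (vol Ω)) {v : H Ω m}
    (hK : 0 < K ε a v) (hI : 0 < I g v) {t : ℝ} (ht : 0 < t) :
    HasDerivAt (fun r : ℝ => E ε a g (r • v)) 0 t ↔ t = Real.sqrt (K ε a v / I g v) :=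
  hasDerivAt_ray_zero_iff (X := H Ω m) hK hI (E_smul hP ha v) ht

set_option synthInstance.maxHeartbeats 200000 in
set_option maxHeartbeats 1000000 in
theorem sqrt_smul_mem_nehari (ha : ∀ i, MemLp (a i) ⊤ (vol Ω)) {v : H Ω m} (hv : v ≠ 0)
    (hK : 0 < K ε a v) (hI : 0 < I g v) :
    Real.sqrt (K ε a v / I g v) • v ∈ nehari Ω ε a g :=
  fderiv_ray_critical (X := H Ω m) (contDiff_E hP ha) hK hI (E_smul hP ha v) hv

set_option synthInstance.maxHeartbeats 200000 in
set_option maxHeartbeats 1000000 in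
theorem K_eq_I_of_mem_nehari (ha : ∀ i, MemLp (a i) ⊤ (vol Ω)) {u : H Ω m}
    (hu : u ∈ nehari Ω ε a g) : K ε a u = I g u :=
  eq_of_fderiv_self_eq_zero (X := H Ω m) (contDiff_E hP ha) (E_smul hP ha u) hu.2

set_option synthInstance.maxHeartbeats 200000 in
set_option maxHeartbeats 1000000 in
theorem fderiv_fderiv_E (ha : ∀ i, MemLp (a i) ⊤ (vol Ω)) (u : H Ω m) :
    fderiv ℝ (fderiv ℝ (E ε a g)) u u u = K ε a u - 3 * I g u :=
  fderiv_fderiv_ray (X := H Ω m) (contDiff_E hP ha) (E_smul hP ha u)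

end Product

end

end NehariSystem

end

/-! ### The theorem. -/

theorem lemma2p1 {N m : ℕ} (hN : 1 ≤ N) (hN' : N ≤ 4)
    (Ω : Set (NehariSystem.Space N)) (hΩ : IsOpen Ω) (hΩb : Bornology.IsBounded Ω)
    (ε : Fin m → ℝ) (hε : ∀ i, 0 < ε i)
    (g : Matrix (Fin m) (Fin m) ℝ) (hg : g.IsSymm)
    (hg' : (∀ i j, 0 < g i j) ∨ g.PosDef)
    (a : Fin m → NehariSystem.Space N → ℝ)
    (ha : ∀ i, MemLp (a i) ⊤ (volume.restrict Ω))
    (ha' : ∀ i, ∀ᵐ x ∂(volume.restrict Ω), -(ε i * NehariSystem.firstEigenvalue Ω) < a i x) :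
    -- the derivatives below exist
    ContDiff ℝ 2 (NehariSystem.E ε a g : NehariSystem.H Ω m → ℝ) ∧
    -- (i)
    (∀ v : NehariSystem.H Ω m, v ≠ 0 → ∃ s : ℝ, 0 < s ∧
      (∀ t : ℝ, 0 < t →
        (HasDerivAt (fun r : ℝ => NehariSystem.E ε a g (r • v)) 0 t ↔ t = s)) ∧
      s • v ∈ NehariSystem.nehari Ω ε a g ∧
      s = Real.sqrt (NehariSystem.K ε a v / NehariSystem.I g v) ∧
      s = Real.sqrt
        ((∑ i, ∫ x in Ω, (ε i * ‖NehariSystem.grad (v i) x‖ ^ 2 +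
            a i x * NehariSystem.fn (v i) x ^ 2)) /
          (∑ i, ∑ j, ∫ x in Ω,
            g i j * NehariSystem.fn (v i) x ^ 2 * NehariSystem.fn (v j) x ^ 2))) ∧
    -- (ii)
    (∀ u ∈ NehariSystem.nehari Ω ε a g,
      fderiv ℝ (fderiv ℝ (NehariSystem.E ε a g)) u u u < 0) ∧
    -- (iii)
    (∃ σ₀ : ℝ, 0 < σ₀ ∧ ∀ u ∈ NehariSystem.nehari Ω ε a g, σ₀ ≤ NehariSystem.hNorm ε u) := by
  obtain ⟨P, hP, C, hC, hPC⟩ := NehariSystem.exists_product hN hN' hΩ hΩb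
  refine ⟨NehariSystem.contDiff_E hP ha, fun v hv => ?_, fun u hu => ?_, ?_⟩
  · have hK := NehariSystem.K_pos hN hΩ hΩb hε ha ha' hv
    have hI := NehariSystem.I_pos hP hΩ hΩb hg' hv
    refine ⟨_, Real.sqrt_pos.2 (div_pos hK hI),
      fun t ht => NehariSystem.hasDerivAt_E_smul_zero_iff hP ha hK hI ht,
      NehariSystem.sqrt_smul_mem_nehari hP ha hv hK hI, rfl, ?_⟩
    rw [NehariSystem.sum_integral_eq_K ha, NehariSystem.sum_integral_eq_I hP]
  · rw [NehariSystem.fderiv_fderiv_E hP ha]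
    have hK := NehariSystem.K_pos hN hΩ hΩb hε ha ha' hu.1
    linarith [NehariSystem.K_eq_I_of_mem_nehari hP ha hu]
  · obtain ⟨c, hc, hcK⟩ := NehariSystem.exists_K_coercive hN hΩ hΩb hε ha ha'
    obtain ⟨D, hD, hDI⟩ := NehariSystem.exists_I_le (g := g) hP hε hC hPC
    -- With `x = ‖u‖²`, `c x ≤ K = I ≤ D x²` gives `c ≤ D x`; `D + 1` avoids division by zero.
    refine ⟨Real.sqrt (c / (D + 1)), Real.sqrt_pos.2 (by positivity), fun u hu => ?_⟩
    refine Real.sqrt_le_iff.2 ⟨Real.sqrt_nonneg _, ?_⟩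
    have hK := NehariSystem.K_pos hN hΩ hΩb hε ha ha' hu.1
    have h1 := hcK u
    have h2 := hDI u
    rw [← NehariSystem.K_eq_I_of_mem_nehari hP ha hu] at h2
    set x := NehariSystem.hNorm ε u ^ 2
    have hx : 0 ≤ x := sq_nonneg _
    -- If `x = 0`, the bound on `I` would force `K ≤ 0`, against positivity.
    have hx0 : x ≠ 0 := fun h0 => by
      rw [h0] at h2
      norm_num at h2
      linarith
    have hxp : 0 < x := hx.lt_of_ne' hx0
    rw [div_le_iff₀ (by positivity)]
    have h3 : c * x ≤ D * x * x := by nlinarith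
    have h4 : c ≤ D * x := le_of_mul_le_mul_right h3 hxp
    linarith
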